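/- Let $\Omega$ be an infinite set and let $\Omega^\Omega$ be the semigroup of all maps $\Omega\to\Omega$ under composition. A subsemigroup $T$ of a semigroup $S$ is \emph{maximal} if $T\neq S$ and $\langle T,s\rangle=S$ for every $s\in S\setminus T$. For $\Sigma\subseteq\Omega$ and $f:\Omega\to\Omega$ (written on the right), a \emph{transversal} of $f|_\Sigma$ is a set $\Gamma\subseteq\Sigma$ such that $f$ is injective on $\Gamma$ and $\Gamma f=\Sigma f$; put $c(f|_\Sigma)=|\Sigma\setminus\Gamma|$ for any such $\Gamma$ (this does not depend on $\Gamma$), $c(f)=c(f|_\Omega)$ and $d(f)=|\Omega\setminus\Omega f|$. Let $\mathfrak F=\{f\in\Omega^\Omega : |\Omega f|<|\Omega|\}$. For an ultrafilter $\mathcal F$ on $\Omega$ let $\operatorname{Sym}(\Omega)_{\{\mathcal F\}}=\{f\in\operatorname{Sym}(\Omega) : (\forall\Sigma\subseteq\Omega)(\Sigma\in\mathcal F\leftrightarrow\Sigma f\in\mathcal F)\}$ be its stabiliser, and for an infinite cardinal $\mu$ let $$U_1(\mathcal F,\mu)=\{f\in\Omega^\Omega : d(f)\geq\mu\text{ or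 }\Omega f\notin\mathcal F\text{ or }(c(f)<\mu\text{ and }(\forall\Sigma\notin\mathcal F)(\Sigma f\notin\mathcal F))\}\cup\mathfrak F,$$ $$U_2(\mathcal F,\mu)=\{f\in\Omega^\Omega : c(f)\geq\mu\text{ or }(\forall\Sigma\in\mathcal F)(c(f|_\Sigma)>0)\text{ or }(d(f)<\mu\text{ and }(\forall\Sigma\in\mathcal F)(\Sigma f\in\mathcal F))\}\cup\mathfrak F.$$ Let $\mathcal F$ be a non-principal ultrafilter on $\Omega$ and let $\kappa$ be the least cardinality of a member of $\mathcal F$. Then $\kappa\geq\aleph_0$, and the maximal subsemigroups of $\Omega^\Omega$ that contain $\operatorname{Sym}(\Omega)_{\{\mathcal F\}}$ but do not contain $\operatorname{Sym}(\Omega)$ are exactly the sets $U_1(\mathcal F,\mu)$ and $U_2(\mathcal F,\mu)$ where $\mu$ is a cardinal with $\kappa<\mu\leq|\Omega|^+$. Consequently, $\Omega^\Omega$ has exactly $2^{2^{|\Omega|}}$ maximal subsemigroups, and these form exactly $2^{2^{|\Omega|}}$ classes under conjugation by elements of $\operatorname{Sym}(\Omega)$. -/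

import Mathlib

universe u

namespace FullTransformation

open Cardinal

/-- A subset `A` of a semigroup `S` is a maximal subsemigroup of `S` if it is a subsemigroup, it is
not all of `S`, and `A` together with any one element outside `A` generates `S`. -/
def IsMaximalSubsemigroup {S : Type*} [Mul S] (A : Set S) : Prop :=
  ∃ T : Subsemigroup S, (T : Set S) = A ∧ T ≠ ⊤ ∧
    ∀ s : S, s ∉ T → Subsemigroup.closure (insert s (T : Set S)) = ⊤

section Parameters

variable {Ω : Type u}

/-- `Γ` is a transversal of the restriction of `f` to `S`. -/
def IsTransversal (f : Ω → Ω) (S Γ : Set Ω) : Prop :=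
  Γ ⊆ S ∧ Set.InjOn f Γ ∧ f '' Γ = f '' S

theorem exists_isTransversal (f : Ω → Ω) (S : Set Ω) : ∃ Γ, IsTransversal f S Γ := by
  obtain ⟨Γ, hΓ, hb⟩ := Set.exists_subset_bijOn S f
  exact ⟨Γ, hΓ, hb.injOn, hb.image_eq⟩

/-- The defect `d(f)` of a self-map: the cardinality of the complement of its image. -/
noncomputable def defect (f : Ω → Ω) : Cardinal.{u} :=
  #((Set.range f)ᶜ : Set Ω)

/-- The collapse `c(f|_S)` of the restriction of `f` to `S`: the cardinality of the complement in
`S` of a transversal of `f|_S` (see `collapseOn_eq` for the independence of the transversal). -/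
noncomputable def collapseOn (f : Ω → Ω) (S : Set Ω) : Cardinal.{u} :=
  #(S \ (exists_isTransversal f S).choose : Set Ω)

/-- The collapse `c(f)` of a self-map. -/
noncomputable def collapse (f : Ω → Ω) : Cardinal.{u} :=
  collapseOn f Set.univ

theorem mk_diff_le_of_isTransversal {f : Ω → Ω} {S Γ Δ : Set Ω}
    (hΓ : IsTransversal f S Γ) (hΔ : IsTransversal f S Δ) :
    #(S \ Γ : Set Ω) ≤ #(S \ Δ : Set Ω) := by
  classical
  have hr : ∀ x ∈ S, ∃ y ∈ Γ, f y = f x := fun x hx => by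
    have h : f x ∈ f '' Γ := hΓ.2.2 ▸ Set.mem_image_of_mem f hx
    exact h
  choose! r hrΓ hrf using hr
  let φ : Ω → Ω := fun x => if x ∈ Δ then r x else x
  have hmaps : ∀ x ∈ S \ Γ, φ x ∈ S \ Δ := by
    intro x hx
    by_cases hd : x ∈ Δ
    · simp only [φ, if_pos hd]
      refine ⟨hΓ.1 (hrΓ x hx.1), fun hm => hx.2 ?_⟩
      rw [← hΔ.2.1 hm hd (hrf x hx.1)]
      exact hrΓ x hx.1
    · simp only [φ, if_neg hd]
      exact ⟨hx.1, hd⟩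
  have hinj : Set.InjOn φ (S \ Γ) := by
    intro x hx y hy hxy
    by_cases hdx : x ∈ Δ <;> by_cases hdy : y ∈ Δ <;>
      simp only [φ, hdx, hdy, if_true, if_false] at hxy
    · apply hΔ.2.1 hdx hdy
      rw [← hrf x hx.1, ← hrf y hy.1, hxy]
    · exact absurd (hxy ▸ hrΓ x hx.1) hy.2
    · exact absurd (hxy ▸ hrΓ y hy.1) hx.2
    · exact hxy
  exact Cardinal.mk_le_of_injective
    (f := fun x : (S \ Γ : Set Ω) => (⟨φ x, hmaps x x.2⟩ : (S \ Δ : Set Ω)))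
    (fun x y h => Subtype.ext (hinj x.2 y.2 (congrArg Subtype.val h)))

/-- The collapse does not depend on the choice of the transversal. -/
theorem collapseOn_eq {f : Ω → Ω} {S Γ : Set Ω} (hΓ : IsTransversal f S Γ) :
    collapseOn f S = #(S \ Γ : Set Ω) :=
  le_antisymm (mk_diff_le_of_isTransversal (exists_isTransversal f S).choose_spec hΓ)
    (mk_diff_le_of_isTransversal hΓ (exists_isTransversal f S).choose_spec)

end Parameters

/-- The symmetric group `Sym(Ω)`, as a subset of the full transformation semigroup. -/
def sym (Ω : Type u) : Set (Function.End Ω) :=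
  {f | Function.Bijective (f : Ω → Ω)}

/-- The stabiliser of a filter in `Sym(Ω)`. -/
def symStabilizer {Ω : Type u} (F : Filter Ω) : Set (Function.End Ω) :=
  {f | Function.Bijective (f : Ω → Ω) ∧ ∀ S : Set Ω, S ∈ F ↔ (f : Ω → Ω) '' S ∈ F}

/-- The self-maps of `Ω` whose image has cardinality less than `|Ω|`. -/
def smallImage (Ω : Type u) : Set (Function.End Ω) :=
  {f | #(Set.range (f : Ω → Ω)) < #Ω}

/-- The set `U₁(F, μ)`. -/
def U₁ {Ω : Type u} (F : Filter Ω) (μ : Cardinal.{u}) : Set (Function.End Ω) :=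
  {f | μ ≤ defect f ∨ Set.range (f : Ω → Ω) ∉ F ∨
    (collapse f < μ ∧ ∀ S : Set Ω, S ∉ F → (f : Ω → Ω) '' S ∉ F)} ∪ smallImage Ω

/-- The set `U₂(F, μ)`. -/
def U₂ {Ω : Type u} (F : Filter Ω) (μ : Cardinal.{u}) : Set (Function.End Ω) :=
  {f | μ ≤ collapse f ∨ (∀ S : Set Ω, S ∈ F → 0 < collapseOn f S) ∨
    (defect f < μ ∧ ∀ S : Set Ω, S ∈ F → (f : Ω → Ω) '' S ∈ F)} ∪ smallImage Ω

/-- The conjugacy class of a subset `A` of the full transformation semigroup under the action of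
`Sym(Ω)`: the set of all `a A a⁻¹`. -/
def conjugacyClass {Ω : Type u} (A : Set (Function.End Ω)) : Set (Set (Function.End Ω)) :=
  {B | ∃ a : Equiv.Perm Ω,
    B = (fun f : Function.End Ω => ((a ∘ f ∘ a.symm : Ω → Ω) : Function.End Ω)) '' A}

end FullTransformation

namespace FullTransformation

open Cardinal Set

/-! ### Defect and collapse of composites; gluing of partial bijections. -/

section Parameters

variable {Ω : Type u}

/-! Let `κ` be the least size of a member of `F`. Permutations fixing a member of `F` pointwise
stabilise `F`, and they are plentiful: a bijection between two sets outside `F` whose complements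
are equinumerous extends to one (`IsNorm.exists_perm_extending`).

Maximality. A map `f` outside `U₁ F μ` or `U₂ F μ` is injective on a large set `Γ` placed suitably
with respect to `F`, and then every `t` factors as `v ∘ f ∘ w` with `v` and `w` in the subsemigroup
(`mem_of_U₁_subset`, `mem_of_U₂_subset`). The hypothesis `κ < μ` is what allows `κ` points to be
removed from `Γ` without changing its comparison with `μ`.

Completeness. Let `A` be maximal, containing the stabiliser but not Sym(Ω), and different from all
the `U`s. By maximality `A` lies in no `U` and in no proper subsemigroup containing Sym(Ω), so for
each relevant `μ` it contains a map violating the corresponding conditions. Transfinite induction on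
`μ`, composing these maps with permutations from the stabiliser, yields in `A` an injection `w`
whose image is outside `F` with complement of size |Ω|, and dually a map `v` that sends some `B`
outside `F`, also with complement of size |Ω|, bijectively onto Ω. Every permutation is then `v ∘ g
∘ w` with `g` in the stabiliser (`IsNorm.sym_subset`), a contradiction.

Counting. There are 2^(2^|Ω|) ultrafilters, `U₁ F |Ω|⁺` determines a non-principal `F`, and a
conjugacy class has at most 2^|Ω| members. -/

theorem exists_isTransversal_superset {f : Ω → Ω} {S Γ : Set Ω} (hS : Γ ⊆ S) (h : InjOn f Γ) :
    ∃ Δ, Γ ⊆ Δ ∧ IsTransversal f S Δ := by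
  obtain ⟨Δ, h1, h2, h3, h4⟩ := h.exists_subset_injOn_subset_range_eq hS
  exact ⟨Δ, h1, h2, h4, h3⟩

theorem exists_transversal (f : Ω → Ω) :
    ∃ Γ : Set Ω, InjOn f Γ ∧ f '' Γ = range f ∧ #(Γᶜ : Set Ω) = collapse f := by
  obtain ⟨Γ, h⟩ := exists_isTransversal f univ
  refine ⟨Γ, h.2.1, by rw [h.2.2, image_univ], ?_⟩
  rw [collapse, collapseOn_eq h, compl_eq_univ_sdiff]

theorem exists_transversal_superset {f : Ω → Ω} {S : Set Ω} (hS : InjOn f S) :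
    ∃ Γ : Set Ω, S ⊆ Γ ∧ InjOn f Γ ∧ f '' Γ = range f ∧ #(Γᶜ : Set Ω) = collapse f := by
  obtain ⟨Γ, h0, h⟩ := exists_isTransversal_superset (subset_univ S) hS
  refine ⟨Γ, h0, h.2.1, by rw [h.2.2, image_univ], ?_⟩
  rw [collapse, collapseOn_eq h, compl_eq_univ_sdiff]

theorem collapse_le_of_injOn {f : Ω → Ω} {Γ : Set Ω} (h : InjOn f Γ) :
    collapse f ≤ #(Γᶜ : Set Ω) := by
  obtain ⟨Δ, h0, -, -, h1⟩ := exists_transversal_superset h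
  rw [← h1]
  exact mk_le_mk_of_subset (compl_subset_compl.2 h0)

theorem collapseOn_pos_iff {f : Ω → Ω} {S : Set Ω} : 0 < collapseOn f S ↔ ¬ InjOn f S := by
  obtain ⟨Γ, h⟩ := exists_isTransversal f S
  rw [collapseOn_eq h, pos_iff_ne_zero, not_iff_not, mk_set_eq_zero_iff, sdiff_eq_empty]
  refine ⟨fun hs => h.2.1.mono hs, fun hi x hx => ?_⟩
  obtain ⟨y, hy, hxy⟩ : f x ∈ f '' Γ := h.2.2 ▸ mem_image_of_mem f hx
  exact hi (h.1 hy) hx hxy ▸ hy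

theorem collapse_eq_zero {f : Ω → Ω} (h : Function.Injective f) : collapse f = 0 := by
  have := collapse_le_of_injOn (Γ := univ) h.injOn
  simpa using this

theorem defect_eq_zero {f : Ω → Ω} (h : Function.Surjective f) : defect f = 0 := by
  simp [defect, h.range_eq]

theorem defect_le_defect_comp (g f : Ω → Ω) : defect g ≤ defect (g ∘ f) :=
  mk_le_mk_of_subset (compl_subset_compl.2 (range_comp_subset_range f g))

theorem collapse_le_collapse_comp (g f : Ω → Ω) : collapse f ≤ collapse (g ∘ f) := by
  obtain ⟨Γ, h, -, h1⟩ := exists_transversal (g ∘ f)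
  rw [← h1]
  exact collapse_le_of_injOn (InjOn.of_comp h)

theorem defect_comp_le (g f : Ω → Ω) : defect (g ∘ f) ≤ defect g + defect f := by
  have : (range (g ∘ f))ᶜ ⊆ (range g)ᶜ ∪ g '' (range f)ᶜ := by
    intro y hy
    by_cases h : y ∈ range g
    · obtain ⟨x, rfl⟩ := h
      refine Or.inr ⟨x, ?_, rfl⟩
      rintro ⟨z, rfl⟩
      exact hy ⟨z, rfl⟩
    · exact Or.inl h
  exact (mk_le_mk_of_subset this).trans ((mk_union_le _ _).trans (add_le_add le_rfl mk_image_le))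

theorem collapse_comp_le (g f : Ω → Ω) : collapse (g ∘ f) ≤ collapse f + collapse g := by
  obtain ⟨Γ, hΓ, -, h1⟩ := exists_transversal f
  obtain ⟨Δ, hΔ, -, h2⟩ := exists_transversal g
  have hi : InjOn (g ∘ f) (Γ ∩ f ⁻¹' Δ) := fun x hx y hy h =>
    hΓ hx.1 hy.1 (hΔ hx.2 hy.2 h)
  refine (collapse_le_of_injOn hi).trans ?_
  have : (Γ ∩ f ⁻¹' Δ)ᶜ ⊆ Γᶜ ∪ (Γ \ f ⁻¹' Δ) := by
    intro x hx
    by_cases h : x ∈ Γ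
    · exact Or.inr ⟨h, fun h' => hx ⟨h, h'⟩⟩
    · exact Or.inl h
  refine (mk_le_mk_of_subset this).trans ((mk_union_le _ _).trans ?_)
  rw [h1, ← h2, ← mk_image_eq_of_injOn f _ (hΓ.mono sdiff_subset)]
  refine add_le_add le_rfl (mk_le_mk_of_subset ?_)
  rintro _ ⟨x, hx, rfl⟩
  exact hx.2

/-- Choose a transversal of `g` extending one of `g` restricted to `range f`. Its points missed by
`f` are sent injectively outside the range of `g ∘ f`. -/
theorem defect_le_comp_add (g f : Ω → Ω) : defect f ≤ defect (g ∘ f) + collapse g := by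
  obtain ⟨Γ', h0, h0', h0''⟩ := exists_isTransversal g (range f)
  obtain ⟨Γ, hs, hΓ, -, h1⟩ := exists_transversal_superset h0'
  have : (range f)ᶜ ⊆ (Γ \ range f) ∪ Γᶜ := by
    intro x hx
    by_cases h : x ∈ Γ
    · exact Or.inl ⟨h, hx⟩
    · exact Or.inr h
  refine (mk_le_mk_of_subset this).trans ((mk_union_le _ _).trans ?_)
  rw [h1, ← mk_image_eq_of_injOn g _ (hΓ.mono sdiff_subset)]
  gcongr
  refine mk_le_mk_of_subset ?_
  rintro _ ⟨y, ⟨hy, hyf⟩, rfl⟩ ⟨z, hz⟩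
  obtain ⟨w, hw, hwz⟩ : g (f z) ∈ g '' Γ' := h0'' ▸ mem_image_of_mem g (mem_range_self z)
  exact hyf (hΓ (hs hw) hy (hwz.trans hz) ▸ h0 hw)

/-- If `Γ` is a transversal of `g ∘ f`, then `g` is injective on `f '' Γ`, whose complement is
covered by `f '' Γᶜ` and the complement of the range of `f`. -/
theorem collapse_le_comp_add (g f : Ω → Ω) : collapse g ≤ collapse (g ∘ f) + defect f := by
  obtain ⟨Γ, hΓ, -, h1⟩ := exists_transversal (g ∘ f)
  refine (collapse_le_of_injOn (Γ := f '' Γ) ?_).trans ?_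
  · rintro _ ⟨x, hx, rfl⟩ _ ⟨y, hy, rfl⟩ h
    rw [hΓ hx hy h]
  have : (f '' Γ)ᶜ ⊆ f '' Γᶜ ∪ (range f)ᶜ := by
    intro y hy
    by_cases h : y ∈ range f
    · obtain ⟨x, rfl⟩ := h
      exact Or.inl ⟨x, fun hx => hy ⟨x, hx, rfl⟩, rfl⟩
    · exact Or.inr h
  refine (mk_le_mk_of_subset this).trans ((mk_union_le _ _).trans ?_)
  rw [← h1]
  gcongr
  · exact mk_image_le
  · exact le_rfl

theorem mk_range_comp_le_left (g f : Ω → Ω) : #(range (g ∘ f)) ≤ #(range g) :=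
  mk_le_mk_of_subset (range_comp_subset_range f g)

theorem mk_range_comp_le_right (g f : Ω → Ω) : #(range (g ∘ f)) ≤ #(range f) := by
  rw [range_comp]
  exact mk_image_le

theorem exists_bijOn_of_mk_eq [Nonempty Ω] {A B : Set Ω} (h : #A = #B) :
    ∃ f : Ω → Ω, BijOn f A B := by
  classical
  obtain ⟨e⟩ := Cardinal.eq.1 h
  obtain ⟨w⟩ := ‹Nonempty Ω›
  refine ⟨fun x => if hx : x ∈ A then e ⟨x, hx⟩ else w, fun x hx => ?_, fun x hx y hy hxy => ?_,
    fun y hy => ?_⟩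
  · simp [hx]
  · simp only [hx, hy, dif_pos] at hxy
    exact congrArg Subtype.val (e.injective (Subtype.ext hxy))
  · exact ⟨e.symm ⟨y, hy⟩, (e.symm ⟨y, hy⟩).2, by simp⟩

theorem exists_bijOn_union {f h : Ω → Ω} {A A' B B' : Set Ω} (hf : BijOn f A B)
    (hh : BijOn h A' B') (hA : Disjoint A A') (hB : Disjoint B B') :
    ∃ k : Ω → Ω, BijOn k (A ∪ A') (B ∪ B') ∧ EqOn k f A ∧ EqOn k h A' := by
  classical
  have e1 : EqOn (A.piecewise f h) f A := fun x hx => piecewise_eq_of_mem _ _ _ hx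
  have e2 : EqOn (A.piecewise f h) h A' := fun x hx =>
    piecewise_eq_of_notMem _ _ _ (disjoint_right.1 hA hx)
  refine ⟨A.piecewise f h, ?_, e1, e2⟩
  have b1 := hf.congr e1.symm
  have b2 := hh.congr e2.symm
  refine b1.union b2 ?_
  rw [injOn_union hA]
  exact ⟨b1.injOn, b2.injOn, fun x hx y hy hxy =>
    disjoint_left.1 hB (b1.mapsTo hx) (hxy ▸ b2.mapsTo hy)⟩

theorem exists_subset_mk_eq_mk_sdiff {S : Set Ω} (h : S.Infinite) :
    ∃ T ⊆ S, #T = #S ∧ #(S \ T : Set Ω) = #S := by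
  obtain ⟨t, v, rfl, hd, hc⟩ := h.exists_union_disjoint_cardinal_eq_of_infinite
  have ht : ℵ₀ ≤ #t := by
    by_contra hlt
    rw [not_le] at hlt
    have h' : ℵ₀ ≤ #(t ∪ v : Set Ω) := infinite_iff.1 h.to_subtype
    exact h'.not_gt ((mk_union_le t v).trans_lt (add_lt_aleph0 hlt (hc ▸ hlt)))
  have e : #(t ∪ v : Set Ω) = #t := by
    rw [mk_union_of_disjoint hd, ← hc, add_eq_self ht]
  refine ⟨t, subset_union_left, e.symm, ?_⟩
  rw [union_sdiff_cancel_left hd.le_bot, e, hc]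

end Parameters

/-! ### Permutations fixing a member of an ultrafilter, and shrinking of transversals. -/

section UltrafilterLemmas

variable {Ω : Type u} {F : Ultrafilter Ω} {κ μ : Cardinal.{u}}

theorem image_sdiff_image_subset (f : Ω → Ω) (S T : Set Ω) : f '' S \ f '' T ⊆ f '' (S \ T) := by
  rintro _ ⟨⟨x, hx, rfl⟩, h⟩
  exact ⟨x, ⟨hx, fun hT => h ⟨x, hT, rfl⟩⟩, rfl⟩

/-- `κ` is the least cardinality of a member of `F`. -/
def IsNorm (F : Ultrafilter Ω) (κ : Cardinal.{u}) : Prop :=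
  IsLeast {c : Cardinal.{u} | ∃ S : Set Ω, S ∈ F ∧ #S = c} κ

theorem IsNorm.le (hκ : IsNorm F κ) {S : Set Ω} (hS : S ∈ F) : κ ≤ #S :=
  hκ.2 ⟨S, hS, rfl⟩

theorem IsNorm.le_mk (hκ : IsNorm F κ) : κ ≤ #Ω := by
  simpa using hκ.le (S := univ) Filter.univ_mem

theorem IsNorm.exists_subset (hκ : IsNorm F κ) {S : Set Ω} (hS : S ∈ F) :
    ∃ K ⊆ S, K ∈ F ∧ #K = κ := by
  obtain ⟨T, hT, h⟩ := hκ.1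
  have hST : S ∩ T ∈ F := Filter.inter_mem hS hT
  exact ⟨S ∩ T, inter_subset_left, hST,
    le_antisymm (h ▸ mk_le_mk_of_subset inter_subset_right) (hκ.le hST)⟩

theorem IsNorm.aleph0_le (hκ : IsNorm F κ) (hF : ∀ α : Ω, F ≠ pure α) : ℵ₀ ≤ κ := by
  obtain ⟨T, hT, rfl⟩ := hκ.1
  by_contra hlt
  rw [not_le, lt_aleph0_iff_set_finite] at hlt
  obtain ⟨x, -, hx⟩ := Ultrafilter.eq_pure_of_finite_mem hlt hT
  exact hF x hx

theorem IsNorm.infinite (hκ : IsNorm F κ) (h0 : ℵ₀ ≤ κ) {S : Set Ω} (hS : S ∈ F) : S.Infinite := by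
  rw [← infinite_coe_iff, infinite_iff]
  exact h0.trans (hκ.le hS)

theorem IsNorm.compl_mem_of_lt (hκ : IsNorm F κ) {S : Set Ω} (hS : #(Sᶜ : Set Ω) < κ) : S ∈ F := by
  by_contra h
  exact (hκ.le (Ultrafilter.compl_mem_iff_notMem.2 h)).not_gt hS

/-- Of two halves of `S`, one lies in `F`; the other leaves room for a permutation to move points
while fixing a member of `F`. -/
theorem exists_subset_mem_mk_sdiff {S : Set Ω} (h : S.Infinite) (hS : S ∈ F) :
    ∃ C ⊆ S, C ∈ F ∧ #(S \ C : Set Ω) = #S := by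
  obtain ⟨T, hT, h1, h2⟩ := exists_subset_mk_eq_mk_sdiff h
  by_cases hF : T ∈ F
  · exact ⟨T, hT, hF, h2⟩
  · refine ⟨S \ T, sdiff_subset, Filter.inter_mem hS (Ultrafilter.compl_mem_iff_notMem.2 hF), ?_⟩
    rw [sdiff_sdiff_cancel_left hT, h1]

/-- `g` fixes every point of some member of `F`. -/
def FixesMember (F : Ultrafilter Ω) (g : Equiv.Perm Ω) : Prop :=
  ∃ C ∈ F, ∀ x ∈ C, g x = x

theorem FixesMember.symm {g : Equiv.Perm Ω} (h : FixesMember F g) : FixesMember F g.symm := by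
  obtain ⟨C, hC, h⟩ := h
  exact ⟨C, hC, fun x hx => by rw [Equiv.symm_apply_eq, h x hx]⟩

theorem FixesMember.image_mem {g : Equiv.Perm Ω} (h : FixesMember F g) {S : Set Ω} (hS : S ∈ F) :
    g '' S ∈ F := by
  obtain ⟨C, hC, h⟩ := h
  filter_upwards [hS, hC] with x hx hxC
  exact ⟨x, hx, h x hxC⟩

theorem FixesMember.image_mem_iff {g : Equiv.Perm Ω} (h : FixesMember F g) {S : Set Ω} :
    g '' S ∈ F ↔ S ∈ F := by
  refine ⟨fun hS => ?_, h.image_mem⟩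
  have := h.symm.image_mem hS
  rwa [Equiv.symm_image_image] at this

theorem FixesMember.mem_symStabilizer {g : Equiv.Perm Ω} (h : FixesMember F g) :
    ((g : Ω → Ω) : Function.End Ω) ∈ symStabilizer (F : Filter Ω) :=
  ⟨g.bijective, fun _ => h.image_mem_iff.symm⟩

/-- Fix pointwise a member `C` of `F` inside `Aᶜ ∩ Bᶜ`, chosen to leave so many points there that
`Aᶜ \ C` and `Bᶜ \ C` still have the sizes of `Aᶜ` and `Bᶜ`. These are then matched arbitrarily. -/
theorem IsNorm.exists_perm_extending (hκ : IsNorm F κ) (h0 : ℵ₀ ≤ κ) {A B : Set Ω} {φ : Ω → Ω}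
    (hφ : BijOn φ A B) (hA : A ∉ F) (hB : B ∉ F) (hc : #(Aᶜ : Set Ω) = #(Bᶜ : Set Ω)) :
    ∃ g : Equiv.Perm Ω, FixesMember F g ∧ EqOn g φ A := by
  have hAB : Aᶜ ∩ Bᶜ ∈ F := Filter.inter_mem (Ultrafilter.compl_mem_iff_notMem.2 hA)
    (Ultrafilter.compl_mem_iff_notMem.2 hB)
  have hinf := hκ.infinite h0 hAB
  have : Nonempty Ω := ⟨hinf.nonempty.some⟩
  obtain ⟨C, hC, hCF, hCc⟩ := exists_subset_mem_mk_sdiff hinf hAB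
  have key : ∀ D : Set Ω, Aᶜ ∩ Bᶜ ⊆ D → #(D \ C : Set Ω) = #D := by
    intro D hD
    refine le_antisymm (mk_le_mk_of_subset sdiff_subset) ?_
    have h1 : D ⊆ (D \ C) ∪ (Aᶜ ∩ Bᶜ) := fun x hx => by
      by_cases h : x ∈ C
      · exact Or.inr (hC h)
      · exact Or.inl ⟨hx, h⟩
    have h2 : #(Aᶜ ∩ Bᶜ : Set Ω) ≤ #(D \ C : Set Ω) := by
      rw [← hCc]; exact mk_le_mk_of_subset (sdiff_subset_sdiff_left hD)
    have h3 : ℵ₀ ≤ #(D \ C : Set Ω) := (h0.trans (hκ.le hAB)).trans h2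
    calc #D ≤ #(D \ C : Set Ω) + #(Aᶜ ∩ Bᶜ : Set Ω) :=
          (mk_le_mk_of_subset h1).trans (mk_union_le _ _)
      _ ≤ #(D \ C : Set Ω) + #(D \ C : Set Ω) := by gcongr
      _ = _ := add_eq_self h3
  have hcc : #(Aᶜ \ C : Set Ω) = #(Bᶜ \ C : Set Ω) := by
    rw [key _ inter_subset_left, key _ inter_subset_right, hc]
  obtain ⟨ψ, hψ⟩ := exists_bijOn_of_mk_eq hcc
  have d1 : ∀ D : Set Ω, Disjoint (Dᶜ \ C) C := fun D => disjoint_sdiff_left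
  obtain ⟨k, hk, -, hkC⟩ := exists_bijOn_union hψ (bijOn_id C) (d1 A) (d1 B)
  rw [sdiff_union_of_subset (hC.trans inter_subset_left),
    sdiff_union_of_subset (hC.trans inter_subset_right)] at hk
  obtain ⟨l, hl, hlA, hlk⟩ := exists_bijOn_union hφ hk disjoint_compl_right disjoint_compl_right
  rw [union_compl_self, union_compl_self, bijOn_univ] at hl
  exact ⟨Equiv.ofBijective l hl, ⟨C, hCF, fun x hx =>
    (hlk (hC hx).1).trans (hkC hx)⟩, hlA⟩

/-- Choose `E ⊆ Aᶜ` equinumerous with `Γᶜ`. If `A ∈ F`, extend a bijection of `E` onto `Γᶜ`. If not,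
enlarge `E` by a member `K` of `F` in `Aᶜ` of size `κ`, which does not change its size because `Γᶜ ∈
F` has at least `κ` points, and extend a bijection of `(E ∪ K)ᶜ` onto `Γ`. -/
theorem IsNorm.exists_perm_image_subset (hκ : IsNorm F κ) (h0 : ℵ₀ ≤ κ) {A Γ : Set Ω}
    (hF : A ∈ F ↔ Γ ∈ F) (hA : #A = #Ω) (hΓ : #Γ = #Ω)
    (hc : #(Γᶜ : Set Ω) ≤ #(Aᶜ : Set Ω)) :
    ∃ g : Equiv.Perm Ω, FixesMember F g ∧ g '' A ⊆ Γ := by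
  have : Nonempty Ω := ⟨(hκ.infinite h0 (S := univ) Filter.univ_mem).nonempty.some⟩
  have hfin : ∀ D : Set Ω, A ⊆ Dᶜ → #(Dᶜ : Set Ω) = #Ω := fun D hD =>
    le_antisymm (mk_set_le _) (hA ▸ mk_le_mk_of_subset hD)
  obtain ⟨E, hE, hEc⟩ := le_mk_iff_exists_subset.1 hc
  by_cases hAF : A ∈ F
  · have hΓF : Γᶜ ∉ F := by
      rw [Ultrafilter.compl_notMem_iff]; exact hF.1 hAF
    have hEF : E ∉ F := fun h => by
      have := Filter.inter_mem hAF h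
      rw [(subset_compl_iff_disjoint_left.1 hE).inter_eq] at this
      exact F.empty_notMem this
    obtain ⟨φ, hφ⟩ := exists_bijOn_of_mk_eq hEc
    obtain ⟨g, hg, hgφ⟩ := hκ.exists_perm_extending h0 hφ hEF hΓF
      (by rw [compl_compl, hΓ, hfin E (subset_compl_comm.1 hE)])
    refine ⟨g, hg, ?_⟩
    rintro _ ⟨x, hx, rfl⟩
    by_contra hn
    obtain ⟨y, hy, hyx⟩ := hφ.surjOn (show g x ∈ Γᶜ from hn)
    rw [← hgφ hy] at hyx
    exact hE hy (g.injective hyx ▸ hx)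
  · have hΓF : Γ ∉ F := fun h => hAF (hF.2 h)
    have hAc := Ultrafilter.compl_mem_iff_notMem.2 hAF
    obtain ⟨K, hK, hKF, hKc⟩ := hκ.exists_subset hAc
    have hDc : #(E ∪ K : Set Ω) = #(Γᶜ : Set Ω) := by
      refine le_antisymm ((mk_union_le _ _).trans ?_)
        (hEc ▸ mk_le_mk_of_subset subset_union_left)
      have hκΓ := hκ.le (Ultrafilter.compl_mem_iff_notMem.2 hΓF)
      rw [hEc, hKc]
      calc _ ≤ #(Γᶜ : Set Ω) + #(Γᶜ : Set Ω) := by gcongr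
        _ = _ := add_eq_self (h0.trans hκΓ)
    have hD : E ∪ K ⊆ Aᶜ := union_subset hE hK
    have hDF : (E ∪ K)ᶜ ∉ F := by
      rw [Ultrafilter.compl_notMem_iff]
      exact Filter.mem_of_superset hKF subset_union_right
    obtain ⟨φ, hφ⟩ := exists_bijOn_of_mk_eq
      ((hfin _ (subset_compl_comm.1 hD)).trans hΓ.symm)
    obtain ⟨g, hg, hgφ⟩ := hκ.exists_perm_extending h0 hφ hDF hΓF (by rw [compl_compl, hDc])
    refine ⟨g, hg, ?_⟩
    rintro _ ⟨x, hx, rfl⟩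
    have hx' := subset_compl_comm.1 hD hx
    rw [hgφ hx']
    exact hφ.mapsTo hx'

/-- Fix `C` and spread the full-sized remainder `B \ C` over `Cᶜ`. A point of `Cᶜ` is recorded to
serve as a constant value off `B` in the maximality arguments. -/
theorem IsNorm.exists_bijOn_univ (hκ : IsNorm F κ) (h0 : ℵ₀ ≤ κ) {B : Set Ω} (hB : B ∈ F)
    (hc : #B = #Ω) : ∃ C ∈ F, C ⊆ B ∧ Cᶜ.Nonempty ∧ ∃ e : Ω → Ω, BijOn e B univ ∧ EqOn e id C := by
  have hinf := hκ.infinite h0 hB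
  have : Nonempty Ω := ⟨hinf.nonempty.some⟩
  obtain ⟨C, hC, hCF, hCc⟩ := exists_subset_mem_mk_sdiff hinf hB
  have hCc' : #(Cᶜ : Set Ω) = #Ω := le_antisymm (mk_set_le _)
    (by rw [← hc, ← hCc]; exact mk_le_mk_of_subset (fun x hx => hx.2))
  obtain ⟨ψ, hψ⟩ := exists_bijOn_of_mk_eq (hCc.trans (hc.trans hCc'.symm))
  obtain ⟨k, hk, -, hkC⟩ := exists_bijOn_union hψ (bijOn_id C) disjoint_sdiff_left
    disjoint_compl_left
  rw [sdiff_union_of_subset hC, compl_union_self] at hk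
  refine ⟨C, hCF, hC, ?_, k, hk, hkC⟩
  rw [nonempty_iff_ne_empty, Ne, ← mk_set_eq_zero_iff, hCc', mk_eq_zero_iff, not_isEmpty_iff]
  exact this

theorem mk_eq_of_mk_sdiff_le {S Γ Γ' : Set Ω} (h0 : ℵ₀ ≤ κ) (hS : S ⊆ Γ') (hκS : κ ≤ #S)
    (hΓ : #Γ = #Ω) (h : #(Γ \ Γ' : Set Ω) ≤ κ) : #Γ' = #Ω := by
  refine le_antisymm (mk_set_le _) ?_
  have h1 : κ ≤ #Γ' := hκS.trans (mk_le_mk_of_subset hS)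
  calc #Ω = #Γ := hΓ.symm
    _ ≤ #(Γ \ Γ' : Set Ω) + #Γ' := le_mk_sdiff_add_mk _ _
    _ ≤ #Γ' + #Γ' := by gcongr; exact h.trans h1
    _ = #Γ' := add_eq_self (h0.trans h1)

theorem mk_compl_lt_of_mk_sdiff_le {Γ Γ' : Set Ω} (h0 : ℵ₀ ≤ κ) (hμ : κ < μ)
    (hΓ : #(Γᶜ : Set Ω) < μ) (h : #(Γ \ Γ' : Set Ω) ≤ κ) : #(Γ'ᶜ : Set Ω) < μ := by
  have : Γ'ᶜ ⊆ Γᶜ ∪ (Γ \ Γ') := fun x hx => by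
    by_cases h : x ∈ Γ
    · exact Or.inr ⟨h, hx⟩
    · exact Or.inl h
  exact ((mk_le_mk_of_subset this).trans (mk_union_le _ _)).trans_lt
    (add_lt_of_lt (h0.trans hμ.le) hΓ (h.trans_lt hμ))

/-- Shrinking a transversal so that it stays in `F` while its image is not in `F`. -/
theorem IsNorm.exists_injOn_image_notMem (hκ : IsNorm F κ) (h0 : ℵ₀ ≤ κ) (hμ : κ < μ) {f : Ω → Ω}
    {S : Set Ω} (hS : S ∈ F) (hi : InjOn f S) (hfS : f '' S ∉ F) (hc : collapse f < μ)
    (hr : #(range f) = #Ω) :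
    ∃ Γ ∈ F, InjOn f Γ ∧ f '' Γ ∉ F ∧ #Γ = #Ω ∧ #(Γᶜ : Set Ω) < μ := by
  obtain ⟨Γ, hSΓ, hΓ, hΓr, hΓc⟩ := exists_transversal_superset hi
  have hΓΩ : #Γ = #Ω := by rw [← mk_image_eq_of_injOn f Γ hΓ, hΓr, hr]
  by_cases h : f '' Γ ∈ F
  -- Removing the preimage of a `κ`-sized member of `F` that avoids `f '' S` costs at most `κ < μ`
  -- points and leaves `S` intact.
  · obtain ⟨K, hK, hKF, hKc⟩ := hκ.exists_subset
      (Filter.inter_mem h (Ultrafilter.compl_mem_iff_notMem.2 hfS))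
    have hsub : S ⊆ Γ \ f ⁻¹' K := fun x hx => ⟨hSΓ hx, fun hxK => (hK hxK).2 ⟨x, hx, rfl⟩⟩
    have hle : #(Γ \ (Γ \ f ⁻¹' K) : Set Ω) ≤ κ := by
      rw [← hKc, ← mk_image_eq_of_injOn f _ (hΓ.mono sdiff_subset)]
      refine mk_le_mk_of_subset ?_
      rintro _ ⟨x, ⟨hx, hxK⟩, rfl⟩
      by_contra hn
      exact hxK ⟨hx, hn⟩
    refine ⟨Γ \ f ⁻¹' K, Filter.mem_of_superset hS hsub, hΓ.mono sdiff_subset, fun hF => ?_,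
      mk_eq_of_mk_sdiff_le h0 hsub (hκ.le hS) hΓΩ hle,
      mk_compl_lt_of_mk_sdiff_le h0 hμ (hΓc ▸ hc) hle⟩
    obtain ⟨y, ⟨x, hx, rfl⟩, hxK⟩ := F.nonempty_of_mem (Filter.inter_mem hF hKF)
    exact hx.2 hxK
  · exact ⟨Γ, Filter.mem_of_superset hS hSΓ, hΓ, h, hΓΩ, hΓc ▸ hc⟩

/-- Shrinking a transversal so that it is not in `F` while its image stays in `F`. -/
theorem IsNorm.exists_injOn_notMem_image_mem (hκ : IsNorm F κ) (h0 : ℵ₀ ≤ κ) (hμ : κ < μ)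
    {f : Ω → Ω} {S : Set Ω} (hS : S ∉ F) (hfS : f '' S ∈ F) (hd : defect f < μ)
    (hr : #(range f) = #Ω) :
    ∃ Γ ∉ F, InjOn f Γ ∧ f '' Γ ∈ F ∧ #Γ = #Ω ∧ #((f '' Γ)ᶜ : Set Ω) < μ := by
  obtain ⟨T, hTS, hT⟩ := exists_subset_bijOn S f
  have hTF : T ∉ F := fun h => hS (Filter.mem_of_superset h hTS)
  have hfT : f '' T ∈ F := by rwa [hT.image_eq]
  obtain ⟨Γ, hTΓ, hΓ, hΓr, hΓc⟩ := exists_transversal_superset hT.injOn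
  have hΓΩ : #Γ = #Ω := by rw [← mk_image_eq_of_injOn f Γ hΓ, hΓr, hr]
  by_cases h : Γ ∈ F
  · obtain ⟨K, hK, hKF, hKc⟩ := hκ.exists_subset
      (Filter.inter_mem h (Ultrafilter.compl_mem_iff_notMem.2 hTF))
    have hsub : T ⊆ Γ \ K := fun x hx => ⟨hTΓ hx, fun hxK => (hK hxK).2 hx⟩
    have hle : #(Γ \ (Γ \ K) : Set Ω) ≤ κ := by
      rw [← hKc]
      exact mk_le_mk_of_subset (by rw [sdiff_sdiff_right_self]; exact inter_subset_right)
    have hle' : #(f '' Γ \ f '' (Γ \ K) : Set Ω) ≤ κ := by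
      refine le_trans ?_ hle
      refine le_trans (mk_le_mk_of_subset ?_) (mk_image_le (f := f))
      exact image_sdiff_image_subset _ _ _
    refine ⟨Γ \ K, fun hF => ?_, hΓ.mono sdiff_subset,
      Filter.mem_of_superset hfT (image_mono hsub),
      mk_eq_of_mk_sdiff_le h0 hsub ?_ hΓΩ hle,
      mk_compl_lt_of_mk_sdiff_le h0 hμ (Γ := f '' Γ) (by rw [hΓr]; exact hd) hle'⟩
    · obtain ⟨x, hx, hxK⟩ := F.nonempty_of_mem (Filter.inter_mem hF hKF)
      exact hx.2 hxK
    · rw [← mk_image_eq_of_injOn f T hT.injOn]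
      exact hκ.le hfT
  · exact ⟨Γ, h, hΓ, Filter.mem_of_superset hfT (image_mono hTΓ), hΓΩ,
      by rw [hΓr]; exact hd⟩

/-- Shrinking a transversal so that neither it nor its image is in `F`. -/
theorem IsNorm.exists_injOn_notMem_image_notMem (hκ : IsNorm F κ) (h0 : ℵ₀ ≤ κ) (hμ : κ < μ)
    (hμΩ : μ ≤ #Ω) {f : Ω → Ω} {Γ : Set Ω} (hi : InjOn f Γ) (hΓ : #Γ = #Ω) :
    ∃ Δ ⊆ Γ, Δ ∉ F ∧ f '' Δ ∉ F ∧ #Δ = #Ω ∧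
      (#(Γᶜ : Set Ω) < μ → #(Δᶜ : Set Ω) < μ) ∧
      (#((f '' Γ)ᶜ : Set Ω) < μ → #((f '' Δ)ᶜ : Set Ω) < μ) := by
  obtain ⟨K, -, hKF, hKc⟩ := hκ.exists_subset (S := univ) Filter.univ_mem
  -- Both `Δ` and `f '' Δ` avoid the member `K` of `F`, and only `κ + κ = κ` points are lost.
  set Δ := Γ \ (K ∪ f ⁻¹' K) with hΔ
  have hle : #(Γ \ Δ : Set Ω) ≤ κ := by
    have : Γ \ Δ ⊆ K ∪ (Γ ∩ f ⁻¹' K) := by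
      intro x hx
      by_cases h : x ∈ K
      · exact Or.inl h
      · refine Or.inr ⟨hx.1, ?_⟩
        by_contra hn
        exact hx.2 ⟨hx.1, fun h' => h'.elim h hn⟩
    refine (mk_le_mk_of_subset this).trans ((mk_union_le _ _).trans ?_)
    rw [hKc, ← mk_image_eq_of_injOn f _ (hi.mono inter_subset_left)]
    calc _ ≤ κ + κ := by
          refine add_le_add le_rfl (hKc ▸ mk_le_mk_of_subset ?_)
          rintro _ ⟨x, hx, rfl⟩
          exact hx.2
      _ = κ := add_eq_self h0
  have hle' : #(f '' Γ \ f '' Δ : Set Ω) ≤ κ := by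
    refine le_trans ?_ hle
    exact (mk_le_mk_of_subset (image_sdiff_image_subset _ _ _)).trans mk_image_le
  refine ⟨Δ, sdiff_subset, fun hF => ?_, fun hF => ?_, ?_,
    fun h => mk_compl_lt_of_mk_sdiff_le h0 hμ h hle,
    fun h => mk_compl_lt_of_mk_sdiff_le h0 hμ h hle'⟩
  · obtain ⟨x, hx, hxK⟩ := F.nonempty_of_mem (Filter.inter_mem hF hKF)
    exact hx.2 (Or.inl hxK)
  · obtain ⟨y, ⟨x, hx, rfl⟩, hxK⟩ := F.nonempty_of_mem (Filter.inter_mem hF hKF)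
    exact hx.2 (Or.inr hxK)
  · refine le_antisymm (mk_set_le _) ?_
    by_contra hlt
    rw [not_le] at hlt
    have h1 : #Γ ≤ #(Γ \ Δ : Set Ω) + #Δ := le_mk_sdiff_add_mk _ _
    rw [hΓ] at h1
    exact h1.not_gt (add_lt_of_lt (h0.trans (hμ.le.trans hμΩ))
      (hle.trans_lt (hμ.trans_le hμΩ)) hlt)

end UltrafilterLemmas

/-! ### `U₁` and `U₂` are maximal subsemigroups that do not contain Sym(Ω). -/

section Subsemigroups

variable {Ω : Type u} {F : Ultrafilter Ω} {κ μ : Cardinal.{u}}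

theorem mem_U₁_iff {f : Ω → Ω} : f ∈ U₁ (F : Filter Ω) μ ↔
    (μ ≤ defect f ∨ range f ∉ F ∨ (collapse f < μ ∧ ∀ S : Set Ω, S ∉ F → f '' S ∉ F)) ∨
      #(range f) < #Ω := Iff.rfl

theorem mem_U₂_iff {f : Ω → Ω} : f ∈ U₂ (F : Filter Ω) μ ↔
    (μ ≤ collapse f ∨ (∀ S : Set Ω, S ∈ F → ¬ InjOn f S) ∨
      (defect f < μ ∧ ∀ S : Set Ω, S ∈ F → f '' S ∈ F)) ∨
      #(range f) < #Ω := by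
  simp only [← collapseOn_pos_iff]
  rfl

/-- A `g` of the third kind cannot repair a failure of `f`: collapsing fewer than `μ` points leaves
a defect of at least `μ` in place, and `g` sends an image outside `F` to a set outside `F`. -/
theorem comp_mem_U₁ (hμ : ℵ₀ ≤ μ) {g f : Ω → Ω} (hg : g ∈ U₁ (F : Filter Ω) μ)
    (hf : f ∈ U₁ (F : Filter Ω) μ) : g ∘ f ∈ U₁ (F : Filter Ω) μ := by
  refine mem_U₁_iff.2 ?_
  rcases mem_U₁_iff.1 hg with hg | hg
  swap
  · exact Or.inr ((mk_range_comp_le_left g f).trans_lt hg)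
  rcases mem_U₁_iff.1 hf with hf | hf
  swap
  · exact Or.inr ((mk_range_comp_le_right g f).trans_lt hf)
  refine Or.inl ?_
  rcases hg with hg | hg | ⟨hgc, hg⟩
  · exact Or.inl (hg.trans (defect_le_defect_comp g f))
  · exact Or.inr (Or.inl fun h => hg (Filter.mem_of_superset h (range_comp_subset_range f g)))
  rcases hf with hf | hf | ⟨hfc, hf⟩
  · refine Or.inl (le_of_not_gt fun h => ?_)
    exact (hf.trans (defect_le_comp_add g f)).not_gt (add_lt_of_lt hμ h hgc)
  · refine Or.inr (Or.inl ?_)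
    rw [range_comp]
    exact hg _ hf
  · refine Or.inr (Or.inr ⟨(collapse_comp_le g f).trans_lt (add_lt_of_lt hμ hfc hgc), ?_⟩)
    intro S hS
    rw [image_comp]
    exact hg _ (hf S hS)

theorem comp_mem_U₂ (hμ : ℵ₀ ≤ μ) {g f : Ω → Ω} (hg : g ∈ U₂ (F : Filter Ω) μ)
    (hf : f ∈ U₂ (F : Filter Ω) μ) : g ∘ f ∈ U₂ (F : Filter Ω) μ := by
  refine mem_U₂_iff.2 ?_
  rcases mem_U₂_iff.1 hg with hg | hg
  swap
  · exact Or.inr ((mk_range_comp_le_left g f).trans_lt hg)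
  rcases mem_U₂_iff.1 hf with hf | hf
  swap
  · exact Or.inr ((mk_range_comp_le_right g f).trans_lt hf)
  refine Or.inl ?_
  rcases hf with hf | hf | ⟨hfd, hf⟩
  · exact Or.inl (hf.trans (collapse_le_collapse_comp g f))
  · exact Or.inr (Or.inl fun S hS h => hf S hS (InjOn.of_comp h))
  rcases hg with hg | hg | ⟨hgd, hg⟩
  · refine Or.inl (le_of_not_gt fun h => ?_)
    exact (hg.trans (collapse_le_comp_add g f)).not_gt (add_lt_of_lt hμ h hfd)
  · exact Or.inr (Or.inl fun S hS h => hg _ (hf S hS) (InjOn.image_of_comp h))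
  · refine Or.inr (Or.inr ⟨(defect_comp_le g f).trans_lt (add_lt_of_lt hμ hgd hfd), ?_⟩)
    intro S hS
    rw [image_comp]
    exact hg _ (hf S hS)

theorem comp_mem {P : Subsemigroup (Function.End Ω)} {g f : Ω → Ω} (hg : g ∈ P) (hf : f ∈ P) :
    g ∘ f ∈ P :=
  P.mul_mem hg hf

/-- `U₁ F μ` as a subsemigroup. -/
def U₁Subsemigroup (F : Ultrafilter Ω) (hμ : ℵ₀ ≤ μ) : Subsemigroup (Function.End Ω) where
  carrier := U₁ (F : Filter Ω) μ
  mul_mem' := comp_mem_U₁ hμ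

/-- `U₂ F μ` as a subsemigroup. -/
def U₂Subsemigroup (F : Ultrafilter Ω) (hμ : ℵ₀ ≤ μ) : Subsemigroup (Function.End Ω) where
  carrier := U₂ (F : Filter Ω) μ
  mul_mem' := comp_mem_U₂ hμ

theorem perm_mem_U₁_iff (hμ : ℵ₀ ≤ μ) {f : Ω → Ω} (hf : Function.Bijective f) :
    f ∈ U₁ (F : Filter Ω) μ ↔ ∀ S : Set Ω, S ∉ F → f '' S ∉ F := by
  have h0 : 0 < μ := aleph0_pos.trans_le hμ
  rw [mem_U₁_iff, defect_eq_zero hf.2, collapse_eq_zero hf.1, hf.2.range_eq, mk_univ]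
  refine ⟨?_, fun h => Or.inl (Or.inr (Or.inr ⟨h0, h⟩))⟩
  rintro ((h | h | h) | h)
  · exact absurd h0 h.not_gt
  · exact absurd Filter.univ_mem h
  · exact h.2
  · exact absurd h (lt_irrefl _)

theorem perm_mem_U₂_iff (hμ : ℵ₀ ≤ μ) {f : Ω → Ω} (hf : Function.Bijective f) :
    f ∈ U₂ (F : Filter Ω) μ ↔ ∀ S : Set Ω, S ∈ F → f '' S ∈ F := by
  have h0 : 0 < μ := aleph0_pos.trans_le hμ
  rw [mem_U₂_iff, defect_eq_zero hf.2, collapse_eq_zero hf.1, hf.2.range_eq, mk_univ]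
  refine ⟨?_, fun h => Or.inl (Or.inr (Or.inr ⟨h0, h⟩))⟩
  rintro ((h | h | h) | h)
  · exact absurd h0 h.not_gt
  · exact absurd hf.1.injOn (h univ Filter.univ_mem)
  · exact h.2
  · exact absurd h (lt_irrefl _)

theorem symStabilizer_subset_U₁ (hμ : ℵ₀ ≤ μ) :
    symStabilizer (F : Filter Ω) ⊆ U₁ (F : Filter Ω) μ := fun f hf => by
  exact (perm_mem_U₁_iff hμ hf.1).2 fun S hS h => hS ((hf.2 S).2 h)

theorem symStabilizer_subset_U₂ (hμ : ℵ₀ ≤ μ) :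
    symStabilizer (F : Filter Ω) ⊆ U₂ (F : Filter Ω) μ := fun f hf => by
  exact (perm_mem_U₂_iff hμ hf.1).2 fun S hS => (hf.2 S).1 hS

/-- Two halves of an infinite member of an ultrafilter can be interchanged. -/
theorem exists_perm_image_notMem (F : Ultrafilter Ω) {S : Set Ω} (h : S.Infinite) (hS : S ∈ F) :
    ∃ g : Equiv.Perm Ω, (∀ x ∉ S, g x = x) ∧ ∃ T ∈ F, g '' T ∉ F := by
  have : Nonempty Ω := ⟨h.nonempty.some⟩
  obtain ⟨T, hT, h1, h2⟩ := exists_subset_mk_eq_mk_sdiff h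
  obtain ⟨φ, hφ⟩ := exists_bijOn_of_mk_eq (h1.trans h2.symm)
  obtain ⟨ψ, hψ⟩ := exists_bijOn_of_mk_eq (h2.trans h1.symm)
  obtain ⟨k, hk, hkφ, hkψ⟩ := exists_bijOn_union hφ hψ disjoint_sdiff_right disjoint_sdiff_left
  rw [union_sdiff_cancel hT, sdiff_union_of_subset hT] at hk
  obtain ⟨l, hl, hlk, hlid⟩ := exists_bijOn_union hk (bijOn_id Sᶜ) disjoint_compl_right
    disjoint_compl_right
  rw [union_compl_self, bijOn_univ] at hl
  refine ⟨Equiv.ofBijective l hl, fun x hx => hlid hx, ?_⟩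
  have e1 : l '' T = S \ T := by
    rw [(hlk.mono hT).image_eq, hkφ.image_eq, hφ.image_eq]
  have e2 : l '' (S \ T) = T := by
    rw [(hlk.mono sdiff_subset).image_eq, hkψ.image_eq, hψ.image_eq]
  have hd : T ∈ F → S \ T ∉ F := fun h h' => by
    have := Filter.inter_mem h h'
    rw [inter_sdiff_self] at this
    exact F.empty_notMem this
  by_cases hTF : T ∈ F
  · exact ⟨T, hTF, by simpa [e1] using hd hTF⟩
  · exact ⟨S \ T, Filter.inter_mem hS (Ultrafilter.compl_mem_iff_notMem.2 hTF),
      by simpa [e2] using hTF⟩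

theorem not_sym_subset_U₁ [Infinite Ω] (F : Ultrafilter Ω) (hμ : ℵ₀ ≤ μ) :
    ¬ sym Ω ⊆ U₁ (F : Filter Ω) μ := fun h => by
  obtain ⟨g, -, T, hT, hgT⟩ := exists_perm_image_notMem F infinite_univ Filter.univ_mem
  have h1 := (perm_mem_U₁_iff hμ g.bijective).1 (h g.bijective) Tᶜ
    (Ultrafilter.compl_notMem_iff.2 hT)
  rw [image_compl_eq g.bijective] at h1
  exact hgT (Ultrafilter.compl_notMem_iff.1 h1)

theorem not_sym_subset_U₂ [Infinite Ω] (F : Ultrafilter Ω) (hμ : ℵ₀ ≤ μ) :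
    ¬ sym Ω ⊆ U₂ (F : Filter Ω) μ := fun h => by
  obtain ⟨g, -, T, hT, hgT⟩ := exists_perm_image_notMem F infinite_univ Filter.univ_mem
  exact hgT ((perm_mem_U₂_iff hμ g.bijective).1 (h g.bijective) T hT)

/-- This normal form is all that maximality and completeness use about a map outside `U₁`. -/
theorem exists_injOn_of_notMem_U₁ (hκ : IsNorm F κ) (h0 : ℵ₀ ≤ κ) (hμ : κ < μ)
    {f : Ω → Ω} (hf : f ∉ U₁ (F : Filter Ω) μ) :
    ∃ Γ : Set Ω, InjOn f Γ ∧ f '' Γ ∈ F ∧ #Γ = #Ω ∧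
      #((f '' Γ)ᶜ : Set Ω) < μ ∧ (Γ ∉ F ∨ μ ≤ #(Γᶜ : Set Ω)) := by
  replace hf := mt mem_U₁_iff.2 hf
  push Not at hf
  obtain ⟨⟨hd, hr, hc⟩, hs⟩ := hf
  have hs' := le_antisymm (mk_set_le _) hs
  by_cases h : collapse f < μ
  · obtain ⟨S, hS, hfS⟩ := hc h
    obtain ⟨Γ, h1, h2, h3, h4, h5⟩ := hκ.exists_injOn_notMem_image_mem h0 hμ hS hfS hd hs'
    exact ⟨Γ, h2, h3, h4, h5, Or.inl h1⟩
  · obtain ⟨Γ, h1, h2, h3⟩ := exists_transversal f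
    exact ⟨Γ, h1, h2 ▸ hr, by rw [← mk_image_eq_of_injOn _ _ h1, h2, hs'], by rw [h2]; exact hd,
      Or.inr (by rw [h3]; exact not_lt.1 h)⟩

theorem exists_injOn_of_notMem_U₂ (hκ : IsNorm F κ) (h0 : ℵ₀ ≤ κ) (hμ : κ < μ)
    {f : Ω → Ω} (hf : f ∉ U₂ (F : Filter Ω) μ) :
    ∃ Γ ∈ F, InjOn f Γ ∧ #Γ = #Ω ∧ #(Γᶜ : Set Ω) < μ ∧
      (f '' Γ ∉ F ∨ μ ≤ #((f '' Γ)ᶜ : Set Ω)) := by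
  replace hf := mt mem_U₂_iff.2 hf
  push Not at hf
  obtain ⟨⟨hc, ⟨S, hS, hi⟩, hd⟩, hs⟩ := hf
  have hs' := le_antisymm (mk_set_le _) hs
  by_cases h : defect f < μ
  · obtain ⟨T, hT, hfT⟩ := hd h
    obtain ⟨Γ, h1, h2, h3, h4, h5⟩ := hκ.exists_injOn_image_notMem h0 hμ
      (Filter.inter_mem hS hT) (hi.mono inter_subset_left)
      (fun h => hfT (Filter.mem_of_superset h (image_mono inter_subset_right))) hc hs'
    exact ⟨Γ, h1, h2, h4, h5, Or.inl h3⟩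
  · obtain ⟨Γ, h0, h1, h2, h3⟩ := exists_transversal_superset hi
    exact ⟨Γ, Filter.mem_of_superset hS h0, h1, by rw [← mk_image_eq_of_injOn _ _ h1, h2, hs'],
      h3 ▸ hc, Or.inr (by rw [h2]; exact not_lt.1 h)⟩

/-- In `t = v ∘ f ∘ w`, the map `v` carries `f '' Γ` bijectively onto Ω and is the identity on a
member of `F`, which puts it in `U₁`. Then `w` may be any map into `Γ` solving the equation: its
range is either outside `F` or of defect at least `μ`. -/
theorem mem_of_U₁_subset (hκ : IsNorm F κ) (h0 : ℵ₀ ≤ κ) (hμ : κ < μ)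
    {P : Subsemigroup (Function.End Ω)} (hP : U₁ (F : Filter Ω) μ ⊆ P) {f : Ω → Ω}
    (hfP : f ∈ P) (hf : f ∉ U₁ (F : Filter Ω) μ) (t : Ω → Ω) : t ∈ P := by
  obtain ⟨Γ, hi, hfΓ, hΓ, hd, hor⟩ := exists_injOn_of_notMem_U₁ hκ h0 hμ hf
  obtain ⟨C, hC, hCΓ, ⟨d, hdC⟩, e, he, heC⟩ := hκ.exists_bijOn_univ h0 hfΓ
    (by rw [mk_image_eq_of_injOn _ _ hi, hΓ])
  classical
  let v : Ω → Ω := (f '' Γ).piecewise e fun _ => d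
  have hve : EqOn v e (f '' Γ) := fun x hx => piecewise_eq_of_mem _ _ _ hx
  have hvd : ∀ x ∉ f '' Γ, v x = d := fun x hx => piecewise_eq_of_notMem _ _ _ hx
  have hv : v ∈ U₁ (F : Filter Ω) μ := by
    refine Or.inl (Or.inr (Or.inr
      ⟨(collapse_le_of_injOn (he.injOn.congr hve.symm)).trans_lt hd, fun S hS h => hS ?_⟩))
    -- A point of `C` has no preimage under `v` but itself: `d ∉ C`, while `e` is injective on `f ''
    -- Γ` and fixes `C`.
    filter_upwards [h, hC] with y hy hyC
    obtain ⟨x, hx, rfl⟩ := hy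
    by_cases hxΓ : x ∈ f '' Γ
    · rw [hve hxΓ] at hyC
      have h2 : e (e x) = e x := heC hyC
      rw [he.injOn (hCΓ hyC) hxΓ h2] at hyC
      rwa [hve hxΓ, heC hyC]
    · rw [hvd x hxΓ] at hyC
      exact absurd hyC hdC
  have hex : ∀ x, ∃ z ∈ Γ, v (f z) = t x := fun x => by
    obtain ⟨_, ⟨z, hz, rfl⟩, hy⟩ := he.surjOn (mem_univ (t x))
    exact ⟨z, hz, (hve ⟨z, hz, rfl⟩).trans hy⟩
  choose w hwΓ hwt using hex
  have hw : w ∈ U₁ (F : Filter Ω) μ := by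
    have hsub : range w ⊆ Γ := range_subset_iff.2 hwΓ
    refine Or.inl ?_
    rcases hor with h | h
    · exact Or.inr (Or.inl fun h' => h (Filter.mem_of_superset h' hsub))
    · exact Or.inl (h.trans (mk_le_mk_of_subset (compl_subset_compl.2 hsub)))
  have ht : t = v ∘ f ∘ w := funext fun x => (hwt x).symm
  rw [ht]
  exact comp_mem (hP hv) (comp_mem hfP (hP hw))

/-- Now `w` is a bijection of Ω onto `Γ` that is the identity on a member of `F`, and `v` absorbs
`t`: it inverts the injection `f ∘ w` on `f '' Γ`, applies `t`, and is constant elsewhere. The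
constancy puts `v` in `U₂`: the complement of `f '' Γ` either is in `F`, so that `v` is injective on
no member of `F`, or has at least `μ` points, so that `v` has collapse at least `μ`. -/
theorem mem_of_U₂_subset (hκ : IsNorm F κ) (h0 : ℵ₀ ≤ κ) (hμ : κ < μ)
    {P : Subsemigroup (Function.End Ω)} (hP : U₂ (F : Filter Ω) μ ⊆ P) {f : Ω → Ω}
    (hfP : f ∈ P) (hf : f ∉ U₂ (F : Filter Ω) μ) (t : Ω → Ω) : t ∈ P := by
  obtain ⟨Γ, hΓF, hi, hΓ, hc, hor⟩ := exists_injOn_of_notMem_U₂ hκ h0 hμ hf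
  obtain ⟨C, hC, hCΓ, ⟨d, -⟩, e, he, heC⟩ := hκ.exists_bijOn_univ h0 hΓF hΓ
  choose w hwΓ hwe using fun x => he.surjOn (mem_univ x)
  have hwr : range w = Γ := by
    refine (range_subset_iff.2 hwΓ).antisymm fun x hx => ⟨e x, ?_⟩
    exact he.injOn (hwΓ _) hx (hwe _)
  have hw : w ∈ U₂ (F : Filter Ω) μ := by
    refine mem_U₂_iff.2 (Or.inl (Or.inr (Or.inr ⟨?_, fun S hS => ?_⟩)))
    · have : defect w = #(Γᶜ : Set Ω) := by rw [defect, hwr]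
      exact this ▸ hc
    · filter_upwards [hS, hC] with x hx hxC
      refine ⟨x, hx, he.injOn (hwΓ _) (hCΓ hxC) ((hwe x).trans (heC hxC).symm)⟩
  classical
  have hex : ∀ y, ∃ z, (y ∈ f '' Γ → ∃ x, f (w x) = y ∧ t x = z) ∧
      (y ∉ f '' Γ → z = d) := fun y => by
    by_cases hy : y ∈ f '' Γ
    · obtain ⟨x, hx, rfl⟩ := hy
      obtain ⟨x, rfl⟩ := hwr.symm ▸ hx
      exact ⟨t x, fun _ => ⟨x, rfl, rfl⟩, fun h => absurd ⟨_, hx, rfl⟩ h⟩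
    · exact ⟨d, fun h => absurd h hy, fun _ => rfl⟩
  choose v hv1 hv2 using hex
  have hsing : ∀ S : Set Ω, InjOn v S → (S ∩ (f '' Γ)ᶜ).Subsingleton := by
    intro S hS x hx y hy
    exact hS hx.1 hy.1 (by rw [hv2 x hx.2, hv2 y hy.2])
  have hv : v ∈ U₂ (F : Filter Ω) μ := by
    refine mem_U₂_iff.2 (Or.inl ?_)
    rcases hor with h | h
    · refine Or.inr (Or.inl fun S hS hSi => ?_)
      exact hκ.infinite h0 (Filter.inter_mem hS (Ultrafilter.compl_mem_iff_notMem.2 h))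
        (hsing S hSi).finite
    · refine Or.inl (le_of_not_gt fun hlt => ?_)
      obtain ⟨Δ, hΔ, -, hΔc⟩ := exists_transversal v
      have hsub : (f '' Γ)ᶜ ⊆ Δᶜ ∪ (Δ ∩ (f '' Γ)ᶜ) := fun x hx => by
        by_cases hxΔ : x ∈ Δ
        · exact Or.inr ⟨hxΔ, hx⟩
        · exact Or.inl hxΔ
      have hμ0 : ℵ₀ ≤ μ := h0.trans hμ.le
      refine (h.trans ((mk_le_mk_of_subset hsub).trans (mk_union_le _ _))).not_gt ?_
      refine add_lt_of_lt hμ0 (hΔc ▸ hlt) ?_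
      exact (lt_aleph0_iff_set_finite.2 (hsing Δ hΔ).finite).trans_le hμ0
  have ht : t = v ∘ f ∘ w := funext fun x => by
    obtain ⟨x', h1, h2⟩ := hv1 (f (w x)) ⟨_, hwΓ x, rfl⟩
    have h3 : w x' = w x := hi (hwΓ _) (hwΓ _) h1
    have h4 : x' = x := by rw [← hwe x', h3, hwe]
    change t x = v (f (w x))
    rw [← h2, h4]
  rw [ht]
  exact comp_mem (hP hv) (comp_mem hfP (hP hw))

theorem isMaximalSubsemigroup_of_forall {T : Subsemigroup (Function.End Ω)} (hT : T ≠ ⊤)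
    (h : ∀ P : Subsemigroup (Function.End Ω), T ≤ P → ∀ f ∈ P, f ∉ T → ∀ t, t ∈ P) :
    IsMaximalSubsemigroup (T : Set (Function.End Ω)) := by
  refine ⟨T, rfl, hT, fun s hs => ?_⟩
  rw [Subsemigroup.eq_top_iff']
  exact h _ ((subset_insert _ _).trans Subsemigroup.subset_closure) s
    (Subsemigroup.subset_closure (mem_insert _ _)) hs

theorem isMaximalSubsemigroup_U₁ [Infinite Ω] (hκ : IsNorm F κ) (h0 : ℵ₀ ≤ κ) (hμ : κ < μ) :
    IsMaximalSubsemigroup (U₁ (F : Filter Ω) μ) := by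
  have hμ0 := h0.trans hμ.le
  refine isMaximalSubsemigroup_of_forall (T := U₁Subsemigroup F hμ0) (fun h => ?_) ?_
  · refine not_sym_subset_U₁ F hμ0 fun f _ => ?_
    change f ∈ U₁Subsemigroup F hμ0
    rw [h]
    trivial
  · exact fun P hP f hf hfU t => mem_of_U₁_subset hκ h0 hμ hP hf hfU t

theorem isMaximalSubsemigroup_U₂ [Infinite Ω] (hκ : IsNorm F κ) (h0 : ℵ₀ ≤ κ) (hμ : κ < μ) :
    IsMaximalSubsemigroup (U₂ (F : Filter Ω) μ) := by
  have hμ0 := h0.trans hμ.le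
  refine isMaximalSubsemigroup_of_forall (T := U₂Subsemigroup F hμ0) (fun h => ?_) ?_
  · refine not_sym_subset_U₂ F hμ0 fun f _ => ?_
    change f ∈ U₂Subsemigroup F hμ0
    rw [h]
    trivial
  · exact fun P hP f hf hfU t => mem_of_U₂_subset hκ h0 hμ hP hf hfU t

end Subsemigroups

/-! ### Every maximal subsemigroup of the required kind is a `U₁` or a `U₂`. -/

section Completeness

variable {Ω : Type u} {F : Ultrafilter Ω} {κ μ : Cardinal.{u}}

theorem IsMaximalSubsemigroup.eq_of_subset {S : Type*} [Mul S] {A : Set S}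
    (hA : IsMaximalSubsemigroup A) {P : Subsemigroup S} (hP : P ≠ ⊤) (h : A ⊆ P) : A = P := by
  obtain ⟨T, rfl, -, hT⟩ := hA
  refine h.antisymm fun s hs => ?_
  by_contra hn
  refine hP (top_unique ?_)
  rw [← hT s hn, Subsemigroup.closure_le]
  exact insert_subset hs h

/-- Otherwise `A` would equal `P` by maximality and so contain Sym(Ω). -/
theorem IsMaximalSubsemigroup.exists_mem_notMem {A : Set (Function.End Ω)}
    (hA : IsMaximalSubsemigroup A) (hs : ¬ sym Ω ⊆ A) {P : Subsemigroup (Function.End Ω)}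
    (hP : P ≠ ⊤) (hsP : sym Ω ⊆ P) : ∃ f : Ω → Ω, f ∈ A ∧ f ∉ P := by
  by_contra! h
  exact hs (hA.eq_of_subset hP h ▸ hsP)

/-- The maps whose collapse is at least `μ` or whose defect is less than `μ`. -/
def geCollapseOrLtDefect (Ω : Type u) (μ : Cardinal.{u}) (hμ : ∀ a < μ, ∀ b < μ, a + b < μ) :
    Subsemigroup (Function.End Ω) where
  carrier := {f | μ ≤ collapse f ∨ defect f < μ}
  mul_mem' := by
    intro g f hg hf
    rcases hf with hf | hf
    · exact Or.inl (hf.trans (collapse_le_collapse_comp g f))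
    rcases hg with hg | hg
    · refine Or.inl (le_of_not_gt fun h => ?_)
      exact (hg.trans (collapse_le_comp_add g f)).not_gt (hμ _ h _ hf)
    · exact Or.inr ((defect_comp_le g f).trans_lt (hμ _ hg _ hf))

/-- The maps whose collapse is less than `μ` or whose defect is at least `μ`. -/
def ltCollapseOrGeDefect (Ω : Type u) (μ : Cardinal.{u}) (hμ : ∀ a < μ, ∀ b < μ, a + b < μ) :
    Subsemigroup (Function.End Ω) where
  carrier := {f | collapse f < μ ∨ μ ≤ defect f}
  mul_mem' := by
    intro g f hg hf
    rcases hg with hg | hg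
    swap
    · exact Or.inr (hg.trans (defect_le_defect_comp g f))
    rcases hf with hf | hf
    · exact Or.inl ((collapse_comp_le g f).trans_lt (hμ _ hf _ hg))
    · refine Or.inr (le_of_not_gt fun h => ?_)
      exact (hf.trans (defect_le_comp_add g f)).not_gt (hμ _ h _ hg)

/-- These maps show that the two preceding subsemigroups are proper when `0 < μ ≤ #Ω`. -/
theorem exists_injective_surjective [Infinite Ω] : ∃ f g : Ω → Ω, Function.Injective f ∧
    Function.Surjective g ∧ defect f = #Ω ∧ collapse g = #Ω := by
  obtain ⟨T, -, h1, h2⟩ := exists_subset_mk_eq_mk_sdiff (infinite_univ (α := Ω))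
  rw [← compl_eq_univ_sdiff, mk_univ] at h2
  obtain ⟨f, hf⟩ := exists_bijOn_of_mk_eq h1.symm
  have hfi := injOn_univ.1 hf.injOn
  have hd : defect f = #Ω := by rw [defect, ← image_univ, hf.image_eq, h2]
  have hg := Function.leftInverse_invFun hfi
  refine ⟨f, Function.invFun f, hfi, hg.surjective, hd, le_antisymm ?_ ?_⟩
  · obtain ⟨Γ, -, -, h⟩ := exists_transversal (Function.invFun f)
    exact h ▸ mk_set_le _
  · have := defect_le_comp_add (Function.invFun f) f
    rwa [hg.comp_eq_id, defect_eq_zero Function.surjective_id, hd, zero_add] at this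

/-- `A` meets the complement of `geCollapseOrLtDefect`. The condition on sums holds for `μ = 1` and
for infinite `μ`, but for no other positive cardinal. -/
theorem IsMaximalSubsemigroup.exists_collapse_lt_defect_ge [Infinite Ω] {A : Set (Function.End Ω)}
    (hA : IsMaximalSubsemigroup A) (hs : ¬ sym Ω ⊆ A) (hμ : ∀ a < μ, ∀ b < μ, a + b < μ)
    (h0 : 0 < μ) (hμΩ : μ ≤ #Ω) : ∃ f : Ω → Ω, f ∈ A ∧ collapse f < μ ∧ μ ≤ defect f := by
  have hne : geCollapseOrLtDefect Ω μ hμ ≠ ⊤ := fun h => by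
    obtain ⟨f, -, hf, -, hd, -⟩ := exists_injective_surjective (Ω := Ω)
    have : f ∈ geCollapseOrLtDefect Ω μ hμ := by rw [h]; trivial
    rcases this with h | h
    · rw [collapse_eq_zero hf] at h
      exact h.not_gt h0
    · rw [hd] at h
      exact h.not_ge hμΩ
  obtain ⟨f, hf, hfP⟩ := hA.exists_mem_notMem hs hne
    (fun f hf => Or.inr (by rw [defect_eq_zero hf.2]; exact h0))
  have := not_or.1 hfP
  exact ⟨f, hf, not_le.1 this.1, not_lt.1 this.2⟩

theorem IsMaximalSubsemigroup.exists_collapse_ge_defect_lt [Infinite Ω] {A : Set (Function.End Ω)}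
    (hA : IsMaximalSubsemigroup A) (hs : ¬ sym Ω ⊆ A) (hμ : ∀ a < μ, ∀ b < μ, a + b < μ)
    (h0 : 0 < μ) (hμΩ : μ ≤ #Ω) : ∃ f : Ω → Ω, f ∈ A ∧ μ ≤ collapse f ∧ defect f < μ := by
  have hne : ltCollapseOrGeDefect Ω μ hμ ≠ ⊤ := fun h => by
    obtain ⟨-, f, -, hf, -, hd⟩ := exists_injective_surjective (Ω := Ω)
    have : f ∈ ltCollapseOrGeDefect Ω μ hμ := by rw [h]; trivial
    rcases this with h | h
    · rw [hd] at h
      exact h.not_ge hμΩ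
    · rw [defect_eq_zero hf] at h
      exact h.not_gt h0
  obtain ⟨f, hf, hfP⟩ := hA.exists_mem_notMem hs hne
    (fun f hf => Or.inl (by rw [collapse_eq_zero hf.1]; exact h0))
  have := not_or.1 hfP
  exact ⟨f, hf, not_lt.1 this.1, not_le.1 this.2⟩

theorem FixesMember.mem {T : Subsemigroup (Function.End Ω)} (hT : symStabilizer (F : Filter Ω) ⊆ T)
    {g : Equiv.Perm Ω} (hg : FixesMember F g) : (g : Ω → Ω) ∈ T :=
  hT hg.mem_symStabilizer

theorem injective_of_collapse_lt_one {f : Ω → Ω} (h : collapse f < 1) : Function.Injective f := by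
  obtain ⟨Γ, hΓ, -, hc⟩ := exists_transversal f
  rw [← hc, Cardinal.lt_one_iff, mk_set_eq_zero_iff, compl_empty_iff] at h
  rwa [h, injOn_univ] at hΓ

theorem surjective_of_defect_lt_one {f : Ω → Ω} (h : defect f < 1) : Function.Surjective f := by
  rw [defect, Cardinal.lt_one_iff, mk_set_eq_zero_iff, compl_empty_iff] at h
  exact range_eq_univ.1 h

/-- Defects of injections add up under composition, so iterating a single map covers the finite
stages of the induction. -/
theorem exists_injective_natCast_le_defect {T : Subsemigroup (Function.End Ω)} {f : Ω → Ω}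
    (hfT : f ∈ T) (hf : Function.Injective f) (hd : 1 ≤ defect f) (n : ℕ) :
    ∃ w : Ω → Ω, w ∈ T ∧ Function.Injective w ∧ (n : Cardinal.{u}) ≤ defect w := by
  induction n with
  | zero => exact ⟨f, hfT, hf, by simp⟩
  | succ n ih =>
    obtain ⟨w, hwT, hw, hn⟩ := ih
    refine ⟨f ∘ w, comp_mem hfT hwT, hf.comp hw, ?_⟩
    have hsub : f '' (range w)ᶜ ∪ (range f)ᶜ ⊆ (range (f ∘ w))ᶜ := by
      rintro y (⟨x, hx, rfl⟩ | hy) ⟨z, hz⟩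
      · exact hx ⟨z, hf hz⟩
      · exact hy ⟨_, hz⟩
    refine le_trans ?_ (mk_le_mk_of_subset hsub)
    rw [mk_union_of_disjoint, mk_image_eq hf, Nat.cast_succ]
    · exact add_le_add hn hd
    · rw [disjoint_compl_right_iff_subset]
      exact image_subset_range _ _

theorem exists_bijOn_natCast_le_mk_compl {T : Subsemigroup (Function.End Ω)} {f : Ω → Ω}
    (hfT : f ∈ T) {Γ : Set Ω} (hf : BijOn f Γ univ) (hd : 1 ≤ #(Γᶜ : Set Ω)) (n : ℕ) :
    ∃ v : Ω → Ω, v ∈ T ∧ ∃ B : Set Ω, BijOn v B univ ∧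
      (n : Cardinal.{u}) ≤ #(Bᶜ : Set Ω) := by
  induction n with
  | zero => exact ⟨f, hfT, Γ, hf, by simp⟩
  | succ n ih =>
    obtain ⟨v, hvT, B, hv, hn⟩ := ih
    refine ⟨f ∘ v, comp_mem hfT hvT, B ∩ v ⁻¹' Γ, ⟨mapsTo_univ _ _, ?_, ?_⟩, ?_⟩
    · exact fun x hx y hy h => hv.injOn hx.1 hy.1 (hf.injOn hx.2 hy.2 h)
    · intro y _
      obtain ⟨x, hx, rfl⟩ := hf.surjOn (mem_univ y)
      obtain ⟨z, hz, rfl⟩ := hv.surjOn (mem_univ x)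
      exact ⟨z, ⟨hz, hx⟩, rfl⟩
    have hsub : Bᶜ ∪ (B ∩ v ⁻¹' Γᶜ) ⊆ (B ∩ v ⁻¹' Γ)ᶜ := by
      rintro x (hx | hx) h
      · exact hx h.1
      · exact hx.2 h.2
    have himg : v '' (B ∩ v ⁻¹' Γᶜ) = Γᶜ := by
      rw [image_inter_preimage, hv.image_eq, univ_inter]
    refine le_trans ?_ (mk_le_mk_of_subset hsub)
    rw [mk_union_of_disjoint, ← mk_image_eq_of_injOn v _ (hv.injOn.mono inter_subset_left), himg,
      Nat.cast_succ]
    · exact add_le_add hn hd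
    · exact disjoint_compl_left.mono_right inter_subset_left

/-- The step of the inductions on injections: a permutation in the stabiliser moves the range of `w`
into `Γ`, where `f` is injective. -/
theorem IsNorm.exists_injective_range_subset (hκ : IsNorm F κ) (h0 : ℵ₀ ≤ κ)
    {T : Subsemigroup (Function.End Ω)} (hT : symStabilizer (F : Filter Ω) ⊆ T) {w f : Ω → Ω}
    {Γ : Set Ω} (hwT : w ∈ T) (hw : Function.Injective w) (hfT : f ∈ T) (hi : InjOn f Γ)
    (hΓ : #Γ = #Ω) (hc : #(Γᶜ : Set Ω) ≤ defect w) (hF : range w ∈ F ↔ Γ ∈ F) :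
    ∃ w' : Ω → Ω, w' ∈ T ∧ Function.Injective w' ∧ range w' ⊆ f '' Γ := by
  obtain ⟨g, hg, hgΓ⟩ := hκ.exists_perm_image_subset h0 hF (mk_range_eq w hw) hΓ hc
  have hmem : ∀ x, g (w x) ∈ Γ := fun x => hgΓ ⟨_, ⟨x, rfl⟩, rfl⟩
  refine ⟨f ∘ g ∘ w, comp_mem hfT (comp_mem (hg.mem hT) hwT), fun x y h => ?_,
    range_subset_iff.2 fun x => ⟨_, hmem x, rfl⟩⟩
  exact hw (g.injective (hi (hmem x) (hmem y) h))

/-- The dual step: a permutation in the stabiliser moves `B` into `f '' Γ`, and `v` is applied after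
pulling back along `f`. -/
theorem IsNorm.exists_bijOn_univ_subset (hκ : IsNorm F κ) (h0 : ℵ₀ ≤ κ)
    {T : Subsemigroup (Function.End Ω)} (hT : symStabilizer (F : Filter Ω) ⊆ T) {v f : Ω → Ω}
    {B Γ : Set Ω} (hvT : v ∈ T) (hv : BijOn v B univ) (hfT : f ∈ T) (hi : InjOn f Γ)
    (hΓ : #Γ = #Ω) (hc : #((f '' Γ)ᶜ : Set Ω) ≤ #(Bᶜ : Set Ω)) (hF : B ∈ F ↔ f '' Γ ∈ F) :
    ∃ v' : Ω → Ω, v' ∈ T ∧ ∃ B' ⊆ Γ, BijOn v' B' univ := by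
  obtain ⟨g, hg, hgΓ⟩ := hκ.exists_perm_image_subset h0 hF
    (by rw [← mk_image_eq_of_injOn v B hv.injOn, hv.image_eq, mk_univ])
    ((mk_image_eq_of_injOn f Γ hi).trans hΓ) hc
  refine ⟨v ∘ g.symm ∘ f, comp_mem hvT (comp_mem (hg.symm.mem hT) hfT),
    Γ ∩ (g.symm ∘ f) ⁻¹' B, inter_subset_left, mapsTo_univ _ _, fun x hx y hy h => ?_,
    fun y _ => ?_⟩
  · exact hi hx.1 hy.1 (g.symm.injective (hv.injOn hx.2 hy.2 h))
  · obtain ⟨b, hb, rfl⟩ := hv.surjOn (mem_univ y)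
    obtain ⟨x, hx, hxb⟩ := hgΓ ⟨b, hb, rfl⟩
    have hxb' : g.symm (f x) = b := by rw [hxb, Equiv.symm_apply_apply]
    exact ⟨x, ⟨hx, show g.symm (f x) ∈ B from hxb' ▸ hb⟩, congrArg v hxb'⟩

/-- If all injections in `T` had range in `F`, their ranges could always be moved into a `Γ ∈ F`,
and the defect could be pushed up to |Ω|⁺, which is impossible. -/
theorem IsNorm.exists_injective_range_notMem (hκ : IsNorm F κ) (h0 : ℵ₀ ≤ κ)
    {T : Subsemigroup (Function.End Ω)} (hT : symStabilizer (F : Filter Ω) ⊆ T)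
    (h1 : ∃ f : Ω → Ω, f ∈ T ∧ collapse f < 1 ∧ 1 ≤ defect f)
    (hS : ∀ μ, ℵ₀ ≤ μ → μ ≤ #Ω → ∃ f : Ω → Ω, f ∈ T ∧ collapse f < μ ∧ μ ≤ defect f)
    (hU : ∀ μ, κ < μ → μ ≤ Order.succ #Ω → ∃ f : Ω → Ω, f ∈ T ∧ f ∉ U₂ (F : Filter Ω) μ) :
    ∃ w : Ω → Ω, w ∈ T ∧ Function.Injective w ∧ range w ∉ F := by
  by_contra! hcon
  have key : ∀ μ ≤ Order.succ #Ω,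
      ∃ w : Ω → Ω, w ∈ T ∧ Function.Injective w ∧ μ ≤ defect w := by
    intro μ
    induction μ using WellFoundedLT.induction with
    | ind μ ih =>
    intro hμ
    rcases lt_or_ge μ ℵ₀ with hfin | hinf
    · obtain ⟨n, rfl⟩ := lt_aleph0.1 hfin
      obtain ⟨f, hf, hc, hd⟩ := h1
      exact exists_injective_natCast_le_defect hf (injective_of_collapse_lt_one hc) hd n
    · obtain ⟨f, hfT, Γ, hΓF, hi, hΓ, hc, hor⟩ : ∃ f : Ω → Ω, f ∈ T ∧ ∃ Γ ∈ F, InjOn f Γ ∧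
          #Γ = #Ω ∧ #(Γᶜ : Set Ω) < μ ∧ (f '' Γ ∉ F ∨ μ ≤ #((f '' Γ)ᶜ : Set Ω)) := by
        -- Up to `κ` no map outside `U₂` is provided, but none is needed: a set whose complement has
        -- fewer than `κ` points is in `F`.
        rcases le_or_gt μ κ with h | h
        · obtain ⟨f, hf, hc, hd⟩ := hS μ hinf (h.trans hκ.le_mk)
          obtain ⟨Γ, hi, hr, hΓc⟩ := exists_transversal f
          rw [← hΓc] at hc
          have hΓF := hκ.compl_mem_of_lt (hc.trans_le h)
          refine ⟨f, hf, Γ, hΓF, hi, ?_, hc, Or.inr (by rw [hr]; exact hd)⟩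
          have : Infinite Ω := infinite_iff.2 (h0.trans hκ.le_mk)
          have := mk_compl_of_infinite _ (hc.trans_le (h.trans hκ.le_mk))
          rwa [compl_compl] at this
        · obtain ⟨f, hf, hfU⟩ := hU μ h hμ
          exact ⟨f, hf, exists_injOn_of_notMem_U₂ hκ h0 h hfU⟩
      -- The induction hypothesis is used at `#Γᶜ < μ`, the defect `w` needs for its range to fit
      -- into `Γ`.
      obtain ⟨w, hwT, hw, hwd⟩ := ih _ hc (hc.le.trans hμ)
      obtain ⟨w', hwT', hw', hr⟩ := hκ.exists_injective_range_subset h0 hT hwT hw hfT hi hΓ hwd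
        (iff_of_true (hcon w hwT hw) hΓF)
      rcases hor with h | h
      · exact absurd (Filter.mem_of_superset (hcon w' hwT' hw') hr) h
      · exact ⟨w', hwT', hw', h.trans (mk_le_mk_of_subset (compl_subset_compl.2 hr))⟩
  obtain ⟨w, -, -, hw⟩ := key _ le_rfl
  exact (Order.succ_le_iff.1 hw).not_ge (mk_set_le _)

/-- Up to `κ` the bound is automatic, since the complement of the range is in `F`. Beyond `κ`,
shrink a transversal so that it and its image are both outside `F`; the range of `w` can then be
moved into it. -/
theorem IsNorm.exists_injective_range_notMem_defect (hκ : IsNorm F κ) (h0 : ℵ₀ ≤ κ)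
    {T : Subsemigroup (Function.End Ω)} (hT : symStabilizer (F : Filter Ω) ⊆ T)
    (hS : ∀ μ, ℵ₀ ≤ μ → μ ≤ #Ω → ∃ f : Ω → Ω, f ∈ T ∧ collapse f < μ ∧ μ ≤ defect f)
    (hw₀ : ∃ w : Ω → Ω, w ∈ T ∧ Function.Injective w ∧ range w ∉ F) (μ : Cardinal.{u})
    (hμ : μ ≤ #Ω) :
    ∃ w : Ω → Ω, w ∈ T ∧ Function.Injective w ∧ range w ∉ F ∧ μ ≤ defect w := by
  induction μ using WellFoundedLT.induction with
  | ind μ ih =>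
  rcases le_or_gt μ κ with h | h
  · obtain ⟨w, hwT, hw, hwF⟩ := hw₀
    exact ⟨w, hwT, hw, hwF, h.trans (hκ.le (Ultrafilter.compl_mem_iff_notMem.2 hwF))⟩
  · obtain ⟨f, hfT, hc, hd⟩ := hS μ (h0.trans h.le) hμ
    obtain ⟨Γ, hi, hr, hΓc⟩ := exists_transversal f
    rw [← hΓc] at hc
    have hΓ : #Γ = #Ω := by
      have : Infinite Ω := infinite_iff.2 (h0.trans hκ.le_mk)
      have := mk_compl_of_infinite _ (hc.trans_le hμ)
      rwa [compl_compl] at this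
    obtain ⟨Δ, hΔΓ, hΔF, hfΔF, hΔ, hΔc, -⟩ := hκ.exists_injOn_notMem_image_notMem h0 h hμ hi hΓ
    obtain ⟨w, hwT, hw, hwF, hwd⟩ := ih _ (hΔc hc) ((hΔc hc).le.trans hμ)
    obtain ⟨w', hwT', hw', hr'⟩ := hκ.exists_injective_range_subset h0 hT hwT hw hfT
      (hi.mono hΔΓ) hΔ hwd (iff_of_false hwF hΔF)
    exact ⟨w', hwT', hw', fun hF => hfΔF (Filter.mem_of_superset hF hr'),
      hd.trans (mk_le_mk_of_subset (compl_subset_compl.2 (hr'.trans (image_subset_range _ _))))⟩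

/-- Dual to `IsNorm.exists_injective_range_notMem`: domains of bijections onto Ω replace ranges of
injections, and `U₁` replaces `U₂`. -/
theorem IsNorm.exists_bijOn_univ_notMem (hκ : IsNorm F κ) (h0 : ℵ₀ ≤ κ)
    {T : Subsemigroup (Function.End Ω)} (hT : symStabilizer (F : Filter Ω) ⊆ T)
    (h1 : ∃ f : Ω → Ω, f ∈ T ∧ 1 ≤ collapse f ∧ defect f < 1)
    (hS : ∀ μ, ℵ₀ ≤ μ → μ ≤ #Ω → ∃ f : Ω → Ω, f ∈ T ∧ μ ≤ collapse f ∧ defect f < μ)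
    (hU : ∀ μ, κ < μ → μ ≤ Order.succ #Ω → ∃ f : Ω → Ω, f ∈ T ∧ f ∉ U₁ (F : Filter Ω) μ) :
    ∃ v : Ω → Ω, v ∈ T ∧ ∃ B ∉ F, BijOn v B univ := by
  by_contra! hcon
  have key : ∀ μ ≤ Order.succ #Ω, ∃ v : Ω → Ω, v ∈ T ∧ ∃ B : Set Ω, BijOn v B univ ∧
      μ ≤ #(Bᶜ : Set Ω) := by
    intro μ
    induction μ using WellFoundedLT.induction with
    | ind μ ih =>
    intro hμ
    rcases lt_or_ge μ ℵ₀ with hfin | hinf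
    · obtain ⟨n, rfl⟩ := lt_aleph0.1 hfin
      obtain ⟨f, hf, hc, hd⟩ := h1
      obtain ⟨Γ, hi, hr, hΓc⟩ := exists_transversal f
      rw [(surjective_of_defect_lt_one hd).range_eq] at hr
      exact exists_bijOn_natCast_le_mk_compl hf (hr ▸ hi.bijOn_image) (hΓc.symm ▸ hc) n
    · obtain ⟨f, hfT, Γ, hi, hΓF, hΓ, hc, hor⟩ : ∃ f : Ω → Ω, f ∈ T ∧ ∃ Γ : Set Ω, InjOn f Γ ∧
          f '' Γ ∈ F ∧ #Γ = #Ω ∧ #((f '' Γ)ᶜ : Set Ω) < μ ∧ (Γ ∉ F ∨ μ ≤ #(Γᶜ : Set Ω)) := by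
        rcases le_or_gt μ κ with h | h
        · obtain ⟨f, hf, hc, hd⟩ := hS μ hinf (h.trans hκ.le_mk)
          obtain ⟨Γ, hi, hr, hΓc⟩ := exists_transversal f
          have hd' : #((f '' Γ)ᶜ : Set Ω) < μ := by rw [hr]; exact hd
          refine ⟨f, hf, Γ, hi, hκ.compl_mem_of_lt (hd'.trans_le h), ?_, hd',
            Or.inr (hΓc.symm ▸ hc)⟩
          have : Infinite Ω := infinite_iff.2 (h0.trans hκ.le_mk)
          have := mk_compl_of_infinite _ (hd'.trans_le (h.trans hκ.le_mk))
          rwa [compl_compl, mk_image_eq_of_injOn f Γ hi] at this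
        · obtain ⟨f, hf, hfU⟩ := hU μ h hμ
          exact ⟨f, hf, exists_injOn_of_notMem_U₁ hκ h0 h hfU⟩
      obtain ⟨v, hvT, B, hv, hvB⟩ := ih _ hc (hc.le.trans hμ)
      obtain ⟨v', hvT', B', hB', hv'⟩ := hκ.exists_bijOn_univ_subset h0 hT hvT hv hfT hi hΓ hvB
        (iff_of_true (by by_contra h; exact hcon v hvT B h hv) hΓF)
      rcases hor with h | h
      · exact absurd hv' (hcon v' hvT' B' fun hF => h (Filter.mem_of_superset hF hB'))
      · exact ⟨v', hvT', B', hv', h.trans (mk_le_mk_of_subset (compl_subset_compl.2 hB'))⟩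
  obtain ⟨v, -, B, -, hB⟩ := key _ le_rfl
  exact (Order.succ_le_iff.1 hB).not_ge (mk_set_le _)

theorem IsNorm.exists_bijOn_univ_notMem_mk_compl (hκ : IsNorm F κ) (h0 : ℵ₀ ≤ κ)
    {T : Subsemigroup (Function.End Ω)} (hT : symStabilizer (F : Filter Ω) ⊆ T)
    (hS : ∀ μ, ℵ₀ ≤ μ → μ ≤ #Ω → ∃ f : Ω → Ω, f ∈ T ∧ μ ≤ collapse f ∧ defect f < μ)
    (hv₀ : ∃ v : Ω → Ω, v ∈ T ∧ ∃ B ∉ F, BijOn v B univ) (μ : Cardinal.{u}) (hμ : μ ≤ #Ω) :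
    ∃ v : Ω → Ω, v ∈ T ∧ ∃ B ∉ F, BijOn v B univ ∧ μ ≤ #(Bᶜ : Set Ω) := by
  induction μ using WellFoundedLT.induction with
  | ind μ ih =>
  rcases le_or_gt μ κ with h | h
  · obtain ⟨v, hvT, B, hBF, hv⟩ := hv₀
    exact ⟨v, hvT, B, hBF, hv, h.trans (hκ.le (Ultrafilter.compl_mem_iff_notMem.2 hBF))⟩
  · obtain ⟨f, hfT, hc, hd⟩ := hS μ (h0.trans h.le) hμ
    obtain ⟨Γ, hi, hr, hΓc⟩ := exists_transversal f
    have hd' : #((f '' Γ)ᶜ : Set Ω) < μ := by rw [hr]; exact hd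
    have hΓ : #Γ = #Ω := by
      have : Infinite Ω := infinite_iff.2 (h0.trans hκ.le_mk)
      have := mk_compl_of_infinite _ (hd'.trans_le hμ)
      rwa [compl_compl, mk_image_eq_of_injOn f Γ hi] at this
    obtain ⟨Δ, hΔΓ, hΔF, hfΔF, hΔ, -, hΔc⟩ := hκ.exists_injOn_notMem_image_notMem h0 h hμ hi hΓ
    obtain ⟨v, hvT, B, hBF, hv, hvB⟩ := ih _ (hΔc hd') ((hΔc hd').le.trans hμ)
    obtain ⟨v', hvT', B', hB', hv'⟩ := hκ.exists_bijOn_univ_subset h0 hT hvT hv hfT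
      (hi.mono hΔΓ) hΔ hvB (iff_of_false hBF hfΔF)
    refine ⟨v', hvT', B', fun hF => hΔF (Filter.mem_of_superset hF hB'), hv', ?_⟩
    rw [← hΓc] at hc
    exact hc.trans (mk_le_mk_of_subset (compl_subset_compl.2 (hB'.trans hΔΓ)))

/-- The partial bijection `v⁻¹ ∘ p ∘ w⁻¹` from `range w` onto `B` joins sets outside `F` whose
complements both have size |Ω|, so it extends to some `g` in the stabiliser, and `p = v ∘ g ∘ w`. -/
theorem IsNorm.sym_subset (hκ : IsNorm F κ) (h0 : ℵ₀ ≤ κ) {T : Subsemigroup (Function.End Ω)}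
    (hT : symStabilizer (F : Filter Ω) ⊆ T) {w v : Ω → Ω} {B : Set Ω} (hwT : w ∈ T)
    (hw : Function.Injective w) (hwF : range w ∉ F) (hwd : #Ω ≤ defect w) (hvT : v ∈ T)
    (hv : BijOn v B univ) (hBF : B ∉ F) (hBc : #Ω ≤ #(Bᶜ : Set Ω)) : sym Ω ⊆ T := by
  intro p hp
  have : Nonempty Ω := mk_ne_zero_iff.1 (aleph0_pos.trans_le (h0.trans hκ.le_mk)).ne'
  have hw' : BijOn w univ (range w) := by
    rw [← image_univ]; exact hw.injOn.bijOn_image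
  have hp' : BijOn (p : Ω → Ω) univ univ := bijOn_univ.2 hp
  have hwi := hw'.symm hw'.invOn_invFunOn.symm
  have hvi := hv.symm hv.invOn_invFunOn.symm
  obtain ⟨g, hg, hgφ⟩ := hκ.exists_perm_extending h0 (hvi.comp (hp'.comp hwi)) hwF hBF
    ((le_antisymm (mk_set_le _) hwd).trans (le_antisymm (mk_set_le _) hBc).symm)
  have : p = v ∘ g ∘ w := by
    funext x
    have h1 := hgφ (mem_range_self x)
    have h2 := hw'.invOn_invFunOn.1 (mem_univ x)
    have h3 := hv.invOn_invFunOn.2 (mem_univ (p (Function.invFunOn w univ (w x))))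
    rw [Function.comp_apply, Function.comp_apply, h1]
    exact (h3.trans (congrArg p h2)).symm
  rw [this]
  exact comp_mem hvT (comp_mem (hg.mem hT) hwT)

theorem IsMaximalSubsemigroup.exists_eq_U [Infinite Ω] (hκ : IsNorm F κ) (h0 : ℵ₀ ≤ κ)
    {A : Set (Function.End Ω)} (hA : IsMaximalSubsemigroup A)
    (hstab : symStabilizer (F : Filter Ω) ⊆ A) (hs : ¬ sym Ω ⊆ A) :
    ∃ μ : Cardinal.{u}, κ < μ ∧ μ ≤ Order.succ #Ω ∧
      (A = U₁ (F : Filter Ω) μ ∨ A = U₂ (F : Filter Ω) μ) := by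
  by_contra! hcon
  have hU1 : ∀ μ, κ < μ → μ ≤ Order.succ #Ω → ∃ f : Ω → Ω, f ∈ A ∧ f ∉ U₁ (F : Filter Ω) μ := by
    intro μ h1 h2
    by_contra! h
    have hμ0 := h0.trans h1.le
    refine (hcon μ h1 h2).1 (hA.eq_of_subset (P := U₁Subsemigroup F hμ0) (fun ht => ?_) h)
    refine not_sym_subset_U₁ F hμ0 fun f _ => ?_
    change f ∈ U₁Subsemigroup F hμ0
    rw [ht]
    trivial
  have hU2 : ∀ μ, κ < μ → μ ≤ Order.succ #Ω → ∃ f : Ω → Ω, f ∈ A ∧ f ∉ U₂ (F : Filter Ω) μ := by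
    intro μ h1 h2
    by_contra! h
    have hμ0 := h0.trans h1.le
    refine (hcon μ h1 h2).2 (hA.eq_of_subset (P := U₂Subsemigroup F hμ0) (fun ht => ?_) h)
    refine not_sym_subset_U₂ F hμ0 fun f _ => ?_
    change f ∈ U₂Subsemigroup F hμ0
    rw [ht]
    trivial
  have a1 : ∀ a < (1 : Cardinal.{u}), ∀ b < (1 : Cardinal.{u}), a + b < 1 := by
    intro a ha b hb
    rw [Cardinal.lt_one_iff] at ha hb
    simp [ha, hb]
  have o1 : (1 : Cardinal.{u}) ≤ #Ω := one_le_aleph0.trans (aleph0_le_mk Ω)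
  have hge1 := hA.exists_collapse_lt_defect_ge hs a1 zero_lt_one o1
  have hlt1 := hA.exists_collapse_ge_defect_lt hs a1 zero_lt_one o1
  have hge : ∀ μ, ℵ₀ ≤ μ → μ ≤ #Ω → ∃ f : Ω → Ω, f ∈ A ∧ collapse f < μ ∧ μ ≤ defect f :=
    fun μ h1 h2 => hA.exists_collapse_lt_defect_ge hs (fun a ha b hb => add_lt_of_lt h1 ha hb)
      (aleph0_pos.trans_le h1) h2
  have hlt : ∀ μ, ℵ₀ ≤ μ → μ ≤ #Ω → ∃ f : Ω → Ω, f ∈ A ∧ μ ≤ collapse f ∧ defect f < μ :=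
    fun μ h1 h2 => hA.exists_collapse_ge_defect_lt hs (fun a ha b hb => add_lt_of_lt h1 ha hb)
      (aleph0_pos.trans_le h1) h2
  obtain ⟨T, rfl, -, -⟩ := hA
  obtain ⟨w, hwT, hw, hwF, hwd⟩ := hκ.exists_injective_range_notMem_defect h0 hstab hge
    (hκ.exists_injective_range_notMem h0 hstab hge1 hge hU2) _ le_rfl
  obtain ⟨v, hvT, B, hBF, hv, hBc⟩ := hκ.exists_bijOn_univ_notMem_mk_compl h0 hstab hlt
    (hκ.exists_bijOn_univ_notMem h0 hstab hlt1 hlt hU1) _ le_rfl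
  exact hs (hκ.sym_subset h0 hstab hwT hw hwF hwd hvT hv hBF hBc)

end Completeness

/-! ### Ultrafilters, maximal subsemigroups and conjugacy classes counted. -/

section Counting

variable {Ω : Type u}

open scoped Classical in
/-- An independent family of sets indexed by the subsets of `Ω`. -/
def independentFamily (A : Set Ω) : Set (Finset Ω × Finset (Finset Ω)) :=
  {p | p.1.filter (· ∈ A) ∈ p.2}

/-- Take one separating point for each pair of distinct sets in `t`. -/
theorem exists_finset_injOn_filter {t : Set (Set Ω)} (ht : t.Finite) :
    ∃ s : Finset Ω, ∀ A ∈ t, ∀ B ∈ t, (∀ x ∈ s, x ∈ A ↔ x ∈ B) → A = B := by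
  classical
  have hd : ∀ p : Set Ω × Set Ω, ∃ x : Finset Ω, p.1 ≠ p.2 → ∃ y ∈ x, ¬ (y ∈ p.1 ↔ y ∈ p.2) := by
    intro p
    by_cases h : p.1 = p.2
    · exact ⟨∅, fun h' => absurd h h'⟩
    · have : ∃ y, ¬ (y ∈ p.1 ↔ y ∈ p.2) := by
        by_contra! hn
        exact h (Set.ext hn)
      obtain ⟨y, hy⟩ := this
      exact ⟨{y}, fun _ => ⟨y, by simp, hy⟩⟩
  choose d hd using hd
  refine ⟨(ht.toFinset ×ˢ ht.toFinset).biUnion d, fun A hA B hB h => ?_⟩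
  by_contra hn
  obtain ⟨y, hy, hy'⟩ := hd (A, B) hn
  exact hy' (h y (Finset.mem_biUnion.2 ⟨(A, B), by simp [hA, hB], hy⟩))

/-- Let `s` be a finite set of points separating the members of `t`, and pair it with the traces on
`s` of those members that are in `𝒜`. -/
theorem independentFamily_independent {t : Set (Set Ω)} (ht : t.Finite) (𝒜 : Set (Set Ω)) :
    ∃ p, ∀ A ∈ t, p ∈ independentFamily A ↔ A ∈ 𝒜 := by
  classical
  obtain ⟨s, hs⟩ := exists_finset_injOn_filter ht
  refine ⟨(s, (ht.toFinset.filter (· ∈ 𝒜)).image fun A => s.filter (· ∈ A)), fun A hA => ?_⟩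
  have hmem : ∀ p : Finset Ω × Finset (Finset Ω),
      p ∈ independentFamily A ↔ p.1.filter (· ∈ A) ∈ p.2 := fun p => by
    simp only [independentFamily, mem_ofPred_eq]
  rw [hmem]
  simp only [Finset.mem_image, Finset.mem_filter, Finite.mem_toFinset]
  constructor
  · rintro ⟨B, ⟨hB, hB𝒜⟩, h⟩
    rw [← hs B hB A hA fun x hx => by simpa [hx] using Finset.ext_iff.1 h x]
    exact hB𝒜
  · exact fun h => ⟨A, ⟨hA, h⟩, rfl⟩

/-- Independence gives the finite intersection property to every choice of sides of the sets of the
family, so each `𝒜` yields an ultrafilter from which it can be read off. The index set has the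
cardinality of Ω. -/
theorem le_mk_ultrafilter [Infinite Ω] : (2 ^ (2 ^ #Ω : Cardinal.{u}) : Cardinal.{u}) ≤
    #(Ultrafilter Ω) := by
  have hX : #Ω = #(Finset Ω × Finset (Finset Ω)) := by
    rw [mk_prod, lift_id, lift_id, mk_finset_of_infinite, mk_finset_of_infinite,
      mk_finset_of_infinite, mul_eq_self (aleph0_le_mk Ω)]
  obtain ⟨e⟩ := Cardinal.eq.1 hX
  have hU : ∀ 𝒜 : Set (Set Ω), ∃ F : Ultrafilter Ω,
      ∀ A, e ⁻¹' independentFamily A ∈ F ↔ A ∈ 𝒜 := by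
    intro 𝒜
    let J : Set Ω → Set Ω := fun A => {x | e x ∈ independentFamily A ↔ A ∈ 𝒜}
    have hne : (⨅ A, Filter.principal (J A)).NeBot := by
      rw [(Filter.hasBasis_iInf_principal_finite J).neBot_iff]
      intro t ht
      obtain ⟨p, hp⟩ := independentFamily_independent ht 𝒜
      refine ⟨e.symm p, mem_iInter₂.2 fun A hA => ?_⟩
      change e (e.symm p) ∈ independentFamily A ↔ A ∈ 𝒜
      rw [Equiv.apply_symm_apply]
      exact hp A hA
    refine ⟨Ultrafilter.of (⨅ A, Filter.principal (J A)), fun A => ?_⟩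
    have hJ : J A ∈ Ultrafilter.of (⨅ A, Filter.principal (J A)) :=
      Ultrafilter.of_le _ (Filter.mem_iInf_of_mem A (Filter.mem_principal_self _))
    constructor
    · intro h
      obtain ⟨x, hx, hxJ⟩ := Ultrafilter.nonempty_of_mem (Filter.inter_mem h hJ)
      exact hxJ.1 hx
    · intro h
      filter_upwards [hJ] with x hx
      exact hx.2 h
  choose U hU using hU
  rw [← mk_set, ← mk_set]
  refine mk_le_of_injective (f := U) fun 𝒜 ℬ h => Set.ext fun A => ?_
  rw [← hU 𝒜, h, hU]

theorem le_mk_nonprincipal [Infinite Ω] : (2 ^ (2 ^ #Ω : Cardinal.{u}) : Cardinal.{u}) ≤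
    #{F : Ultrafilter Ω // ∀ α : Ω, F ≠ pure α} := by
  have h := le_mk_ultrafilter (Ω := Ω)
  have hlt : #Ω < #(Ultrafilter Ω) := ((cantor _).trans (cantor _)).trans_le h
  have : Infinite (Ultrafilter Ω) := infinite_iff.2 ((aleph0_le_mk Ω).trans hlt.le)
  have hr : #(range (pure : Ω → Ultrafilter Ω)) < #(Ultrafilter Ω) := mk_range_le.trans_lt hlt
  rw [← mk_compl_of_infinite _ hr] at h
  refine h.trans (mk_le_mk_of_subset (s := (range (pure : Ω → Ultrafilter Ω))ᶜ)
    (t := {F : Ultrafilter Ω | ∀ α : Ω, F ≠ pure α}) fun F hF α hα => hF ⟨α, hα.symm⟩)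

theorem exists_isNorm (F : Ultrafilter Ω) : ∃ κ, IsNorm F κ :=
  ⟨_, csInf_mem ⟨_, univ, Filter.univ_mem, rfl⟩, fun _ h => csInf_le' h⟩

/-- The value |Ω|⁺ exceeds `κ` whatever `F` is, so one `μ` serves all non-principal ultrafilters. -/
theorem isMaximalSubsemigroup_U₁_succ [Infinite Ω] {F : Ultrafilter Ω} (hF : ∀ α : Ω, F ≠ pure α) :
    IsMaximalSubsemigroup (U₁ (F : Filter Ω) (Order.succ #Ω)) := by
  obtain ⟨κ, hκ⟩ := exists_isNorm F
  exact isMaximalSubsemigroup_U₁ hκ (hκ.aleph0_le hF) (Order.lt_succ_of_le hκ.le_mk)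

/-- If `S ∈ F` and `Sᶜ ∈ F'`, a permutation interchanging two halves of `Sᶜ` and fixing `S`
pointwise stabilises `F` but not `F'`. -/
theorem eq_of_U₁_eq [Infinite Ω] {F F' : Ultrafilter Ω} (hF' : ∀ α : Ω, F' ≠ pure α)
    {μ : Cardinal.{u}} (hμ : ℵ₀ ≤ μ) (h : U₁ (F : Filter Ω) μ = U₁ (F' : Filter Ω) μ) :
    F = F' := by
  by_contra hne
  obtain ⟨S, hS, hS'⟩ : ∃ S ∈ F, S ∉ F' := by
    by_contra! hn
    exact hne (Ultrafilter.eq_of_le (fun S hS => by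
      by_contra hSF
      exact Ultrafilter.compl_notMem_iff.2 hS (hn _ (Ultrafilter.compl_mem_iff_notMem.2 hSF))))
  rw [← Ultrafilter.compl_mem_iff_notMem] at hS'
  obtain ⟨κ, hκ⟩ := exists_isNorm F'
  obtain ⟨g, hg, T, hT, hgT⟩ := exists_perm_image_notMem F'
    (hκ.infinite (hκ.aleph0_le hF') hS') hS'
  have hfix : FixesMember F g := ⟨S, hS, fun x hx => hg x fun h => h hx⟩
  have hmem : (g : Ω → Ω) ∈ U₁ (F' : Filter Ω) μ :=
    h ▸ symStabilizer_subset_U₁ hμ hfix.mem_symStabilizer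
  have h1 := (perm_mem_U₁_iff hμ g.bijective).1 hmem Tᶜ (Ultrafilter.compl_notMem_iff.2 hT)
  rw [image_compl_eq g.bijective] at h1
  exact hgT (Ultrafilter.compl_notMem_iff.1 h1)

theorem mk_maximalSubsemigroups (Ω : Type u) [Infinite Ω] :
    #{A : Set (Function.End Ω) // IsMaximalSubsemigroup A} = 2 ^ (2 ^ #Ω : Cardinal.{u}) := by
  refine le_antisymm ?_ ?_
  · refine (mk_set_le _).trans ?_
    have : #(Function.End Ω) = 2 ^ #Ω := by
      rw [← power_self_eq (aleph0_le_mk Ω), power_def]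
      rfl
    rw [mk_set, this]
  · refine le_mk_nonprincipal.trans
      (mk_le_of_injective (f := fun F : {F : Ultrafilter Ω // ∀ α : Ω, F ≠ pure α} =>
        (⟨U₁ (F.1 : Filter Ω) (Order.succ #Ω), isMaximalSubsemigroup_U₁_succ F.2⟩ :
          {A : Set (Function.End Ω) // IsMaximalSubsemigroup A})) fun F F' h => ?_)
    exact Subtype.ext (eq_of_U₁_eq F'.2 ((aleph0_le_mk Ω).trans (Order.le_succ _))
      (congrArg Subtype.val h))

theorem self_mem_conjugacyClass (A : Set (Function.End Ω)) : A ∈ conjugacyClass A :=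
  ⟨Equiv.refl Ω, (image_id A).symm⟩

theorem mk_conjugacyClasses (Ω : Type u) [Infinite Ω] :
    #{C : Set (Set (Function.End Ω)) // ∃ A, IsMaximalSubsemigroup A ∧ C = conjugacyClass A} =
      2 ^ (2 ^ #Ω : Cardinal.{u}) := by
  have hM := mk_maximalSubsemigroups Ω
  refine le_antisymm ?_ ?_
  · rw [← hM]
    refine mk_le_of_surjective (f := fun A => ⟨conjugacyClass A.1, A.1, A.2, rfl⟩) ?_
    rintro ⟨_, A, hA, rfl⟩
    exact ⟨⟨A, hA⟩, rfl⟩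
  -- A maximal subsemigroup is recovered from its class and a permutation conjugating the chosen
  -- representative to it. As there are only 2^|Ω| permutations, fewer than 2^(2^|Ω|) classes would
  -- not suffice.
  · have hinj : ∀ A : {A : Set (Function.End Ω) // IsMaximalSubsemigroup A},
        ∃ p : {C : Set (Set (Function.End Ω)) //
            ∃ A, IsMaximalSubsemigroup A ∧ C = conjugacyClass A} × Equiv.Perm Ω,
          A.1 = (fun f : Function.End Ω => ((p.2 ∘ f ∘ p.2.symm : Ω → Ω) : Function.End Ω)) ''
            p.1.2.choose := by
      intro A
      let C : {C : Set (Set (Function.End Ω)) //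
        ∃ A, IsMaximalSubsemigroup A ∧ C = conjugacyClass A} := ⟨conjugacyClass A.1, A.1, A.2, rfl⟩
      have hA : A.1 ∈ conjugacyClass C.2.choose := by
        rw [← C.2.choose_spec.2]
        exact self_mem_conjugacyClass _
      obtain ⟨a, ha⟩ := hA
      exact ⟨(C, a), ha⟩
    choose p hp using hinj
    have hle := mk_le_of_injective (f := p) fun A B h => Subtype.ext (by rw [hp A, hp B, h])
    rw [hM, mk_prod, lift_id, lift_id, mk_perm_eq_self_power,
      power_self_eq (aleph0_le_mk Ω)] at hle
    by_contra hlt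
    rw [not_le] at hlt
    exact hle.not_gt (mul_lt_of_lt (((aleph0_le_mk Ω).trans (cantor _).le).trans (cantor _).le)
      hlt (cantor _))

end Counting

end FullTransformation

theorem theoremC (Ω : Type u) [Infinite Ω] :
    (∀ F : Ultrafilter Ω, (∀ α : Ω, F ≠ pure α) →
      ∀ κ : Cardinal.{u},
        IsLeast {c : Cardinal.{u} | ∃ S : Set Ω, S ∈ F ∧ Cardinal.mk S = c} κ →
        Cardinal.aleph0 ≤ κ ∧
        ∀ A : Set (Function.End Ω),
          (FullTransformation.IsMaximalSubsemigroup A ∧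
              FullTransformation.symStabilizer (F : Filter Ω) ⊆ A ∧
              ¬ FullTransformation.sym Ω ⊆ A) ↔
            ∃ μ : Cardinal.{u}, κ < μ ∧ μ ≤ Order.succ (Cardinal.mk Ω) ∧
              (A = FullTransformation.U₁ (F : Filter Ω) μ ∨
                A = FullTransformation.U₂ (F : Filter Ω) μ)) ∧
    Cardinal.mk {A : Set (Function.End Ω) // FullTransformation.IsMaximalSubsemigroup A} =
      2 ^ (2 ^ Cardinal.mk Ω : Cardinal.{u}) ∧
    Cardinal.mk {C : Set (Set (Function.End Ω)) //
        ∃ A, FullTransformation.IsMaximalSubsemigroup A ∧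
          C = FullTransformation.conjugacyClass A} =
      2 ^ (2 ^ Cardinal.mk Ω : Cardinal.{u}) := by
  refine ⟨fun F hF κ hκ => ?_, FullTransformation.mk_maximalSubsemigroups Ω,
    FullTransformation.mk_conjugacyClasses Ω⟩
  replace hκ : FullTransformation.IsNorm F κ := hκ
  have h0 := hκ.aleph0_le hF
  refine ⟨h0, fun A => ⟨fun h => h.1.exists_eq_U hκ h0 h.2.1 h.2.2, ?_⟩⟩
  rintro ⟨μ, hμ, -, rfl | rfl⟩
  · exact ⟨FullTransformation.isMaximalSubsemigroup_U₁ hκ h0 hμ,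
      FullTransformation.symStabilizer_subset_U₁ (h0.trans hμ.le),
      FullTransformation.not_sym_subset_U₁ F (h0.trans hμ.le)⟩
  · exact ⟨FullTransformation.isMaximalSubsemigroup_U₂ hκ h0 hμ,
      FullTransformation.symStabilizer_subset_U₂ (h0.trans hμ.le),
      FullTransformation.not_sym_subset_U₂ F (h0.trans hμ.le)⟩
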